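/- **Theorem (Weighted Euclidean distance estimation).** *Model.* Let $n\ge 1$, $q=\lceil\log_2 n\rceil$. A unitary $U$ on $q$ qubits prepares a unit vector $w\in\mathbb C^n$ if $U|0\rangle=\sum_{i<n}w_i|i\rangle$. A quantum algorithm with black-box access to two such unitaries $U_v,U_c$ is run by a classical controller: it adaptively, finitely many times, runs a circuit on qubits initialised to $|0\rangle$, measures all of them in the computational basis, and finally outputs a real number. Circuits consist of arbitrary one- and two-qubit gates and of uses of $U_v,U_c$, their inverses, and the controlled versions of these. Each use of $U_v$ (inverted and/or controlled or not) takes time $T_v\ge 0$, each use of $U_c$ takes time $T_c\ge 0$. The time of an algorithm is the total over all circuit executions, in the worst case over the measurement outcomes; classical computation is not counted. *Statement.* There is a universal constant $C>0$ such that for all $n$, all weights $\alpha,\beta\in\mathbb C$ with $\max(|\alpha|,|\beta|)\ge 1$, and all $\delta>0$, $\epsilon>0$, there is a quantum algorithm (depending only on $n,\alpha,\beta,\delta,\epsilon$) with the following properties. 1. For all unit vectors $v,c\in\mathbb C^n$ and all unitaries $U_v,U_c$ preparing them, the algorithm outputs, with probability greater than $1-\delta$, a number $\overline d$ with $|\overline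 d-d|\le\epsilon$, where $d=\|\alpha v-\beta c\|$ (Euclidean norm). 2. For all $T_v,T_c\ge 0$, the time spent in the uses of $U_v$ and $U_c$ is at most $$C\,(T_v+T_c)\,\frac{|\alpha||\beta|}{\epsilon}\,\max\{1,\log(1/\delta)\}.$$ 3. If one- and two-qubit gates take unit time and $T_v+T_c\ge\max\{1,q/2\}$, then the total time, including these gates, is also at most $$C\,(T_v+T_c)\,\frac{|\alpha||\beta|}{\epsilon}\,\max\{1,\log(1/\delta)\}.$$ -/

import Mathlib

open scoped NNReal Matrix

noncomputable section

namespace QAlg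

/-- Labels of the computational basis of an `m`-qubit register. -/
abbrev Bits (m : ℕ) : Type := Fin m → Bool

/-- The all-zero basis state of `m` qubits. -/
def zeroState (m : ℕ) : Bits m → ℂ := Pi.single (fun _ => false) 1

/-- The amplitude encoding `∑ i, v i |i⟩` of `v` on `q` qubits, the index `i` being written in
binary (qubit `k` carries the bit of weight `2 ^ k`); the other amplitudes are `0`. -/
def encode (q : ℕ) {n : ℕ} (v : EuclideanSpace ℂ (Fin n)) : Bits q → ℂ :=
  fun b => ∑ i : Fin n, if (fun k : Fin q => Nat.testBit i k) = b then v i else 0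

/-- `U` maps `|0⟩` to `|v⟩`. -/
def Prepares {q n : ℕ} (U : Matrix.unitaryGroup (Bits q) ℂ) (v : EuclideanSpace ℂ (Fin n)) :
    Prop :=
  (U : Matrix (Bits q) (Bits q) ℂ) *ᵥ zeroState q = encode q v

/-- The `k`-qubit operator `G` acting on the wires `w 0, …, w (k - 1)` of an `m`-qubit register,
and as the identity on all other wires. -/
def onWires {k m : ℕ} (w : Fin k ↪ Fin m) (G : Matrix (Bits k) (Bits k) ℂ) :
    Matrix (Bits m) (Bits m) ℂ :=
  open Classical in
  Matrix.of fun x y =>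
    if ∀ i, i ∉ Set.range w → x i = y i then G (fun j => x (w j)) (fun j => y (w j)) else 0

/-- The controlled version `|0⟩⟨0| ⊗ 1 + |1⟩⟨1| ⊗ G` of a `k`-qubit operator `G`; qubit `0` is the
control, qubits `1, …, k` are the target. -/
def controlled {k : ℕ} (G : Matrix (Bits k) (Bits k) ℂ) :
    Matrix (Bits (k + 1)) (Bits (k + 1)) ℂ :=
  Matrix.of fun x y =>
    if x 0 = y 0 then
      (if x 0 = true then G (Fin.tail x) (Fin.tail y)
        else (1 : Matrix (Bits k) (Bits k) ℂ) (Fin.tail x) (Fin.tail y))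
    else 0

/-- The names of the two state-preparation unitaries. -/
inductive OracleName : Type
  | v
  | c

/-- The gates of a circuit on `m` qubits with black-box access to two `q`-qubit unitaries:
arbitrary one- and two-qubit gates, and the unitaries, their inverses (`inv = true`), and the
controlled versions of all of these. -/
inductive Gate (q m : ℕ) : Type
  | one (G : Matrix.unitaryGroup (Bits 1) ℂ) (w : Fin 1 ↪ Fin m)
  | two (G : Matrix.unitaryGroup (Bits 2) ℂ) (w : Fin 2 ↪ Fin m)
  | oracle (o : OracleName) (inv : Bool) (w : Fin q ↪ Fin m)
  | ctrlOracle (o : OracleName) (inv : Bool) (w : Fin (q + 1) ↪ Fin m)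

/-- The unitary that an oracle gate stands for. -/
def oracleMatrix {q : ℕ} (Uv Uc : Matrix.unitaryGroup (Bits q) ℂ) (o : OracleName) (inv : Bool) :
    Matrix (Bits q) (Bits q) ℂ :=
  let U : Matrix (Bits q) (Bits q) ℂ := match o with
    | .v => Uv
    | .c => Uc
  if inv = true then Uᴴ else U

/-- The action of a gate on the whole register. -/
def Gate.matrix {q m : ℕ} (Uv Uc : Matrix.unitaryGroup (Bits q) ℂ) :
    Gate q m → Matrix (Bits m) (Bits m) ℂ
  | .one G w => onWires w G
  | .two G w => onWires w G
  | .oracle o inv w => onWires w (oracleMatrix Uv Uc o inv)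
  | .ctrlOracle o inv w => onWires w (controlled (oracleMatrix Uv Uc o inv))

/-- The time taken by a gate, if a one- or two-qubit gate takes time `T₁` and a use of the first
or second unitary (possibly inverted or controlled) takes time `Tv` or `Tc`. -/
def Gate.time {q m : ℕ} (T₁ Tv Tc : ℝ≥0) : Gate q m → ℝ≥0
  | .one _ _ => T₁
  | .two _ _ => T₁
  | .oracle .v _ _ => Tv
  | .oracle .c _ _ => Tc
  | .ctrlOracle .v _ _ => Tv
  | .ctrlOracle .c _ _ => Tc

/-- A circuit is a list of gates; the head of the list is applied first. -/
abbrev Circuit (q m : ℕ) : Type := List (Gate q m)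

/-- The state obtained by running a circuit on the all-zero state. -/
def Circuit.state {q m : ℕ} (Uv Uc : Matrix.unitaryGroup (Bits q) ℂ) (K : Circuit q m) :
    Bits m → ℂ :=
  K.foldl (fun ψ g => g.matrix Uv Uc *ᵥ ψ) (zeroState m)

def Circuit.time {q m : ℕ} (T₁ Tv Tc : ℝ≥0) (K : Circuit q m) : ℝ≥0 :=
  (K.map (Gate.time T₁ Tv Tc)).sum

/-- A quantum algorithm with a classical controller that outputs a real number. It either stops
with an output, or runs a circuit on fresh qubits in the all-zero state, measures all of them in
the computational basis, and continues depending on the outcome. The algorithm refers to the two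
state-preparation unitaries only as black boxes. -/
inductive Algorithm (q : ℕ) : Type
  | output (d : ℝ)
  | measure (m : ℕ) (K : Circuit q m) (next : Bits m → Algorithm q)

/-- The probability that the output of the algorithm lies in `S`, by the Born rule. -/
def Algorithm.prob {q : ℕ} (Uv Uc : Matrix.unitaryGroup (Bits q) ℂ) (S : Set ℝ) :
    Algorithm q → ℝ
  | .output d => S.indicator (fun _ => 1) d
  | .measure _ K next => ∑ x, ‖K.state Uv Uc x‖ ^ 2 * (next x).prob Uv Uc S

/-- The worst-case total time of all circuit executions, over all measurement outcomes. -/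
def Algorithm.time {q : ℕ} (T₁ Tv Tc : ℝ≥0) : Algorithm q → ℝ≥0
  | .output _ => 0
  | .measure _ K next => K.time T₁ Tv Tc + Finset.univ.sup fun x => (next x).time T₁ Tv Tc

end QAlg

end

namespace QAlg

open Matrix Function

/-! ### Gates acting on vectors -/

/-! Let `u` be the phase of `star α * β` and let `φ ∈ [0, π]` have cosine `re (u * ⟪v, c⟫)`. Then
`d` is the third side of a triangle with sides `‖α‖`, `‖β‖` enclosing the angle `φ`, and it is
Lipschitz in `φ` with constant `m = min ‖α‖ ‖β‖` (`norm_smul_sub_smul_eq_thirdSide`,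
`abs_thirdSide_sub_le`). If `m ≤ ε`, the number `max ‖α‖ ‖β‖` is a valid answer without any
measurement. Otherwise it suffices to know `φ` up to `ε / m`.

The state `χ = (|1⟩|v⟩ + u|0⟩|c⟩)/√2` costs one use of each unitary, and the flip `X` of the control
qubit has expectation `cos φ` in it. The product of `X` and the reflection about `χ` is a rotation
of the plane spanned by `χ` and `X χ`, as in amplitude amplification. After `j` steps, measuring the
control in the Hadamard basis gives `0` with probability `(1 + cos ((2j+1)φ))/2` (`walk_norm`,
`testCircuit_prob_false`), at the price of `2j+1` uses of each unitary.

The angle is then found by a trisection search (`exists_search`). For an interval of radius `h`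
there is an odd `k ≤ 2/h` for which `cos (kφ)` separates the outer thirds by a constant
(`exists_odd_cos_gap`). By a Chernoff bound (`repeatTest_chernoff`), `O(L + i)` repetitions discard
a wrong outer third with error `δ 2^{-i}`, where `i` counts the remaining stages and `L = max 1 (log
(1/δ))`. The costs `(L + i)/h` form a series dominated by the finest stage, so no factor `log (1/ε)`
appears, and the total is `O(L m/ε)`. Finally `m ≤ ‖α‖‖β‖` because the larger weight is at least
`1`.

The elementary gates number `O(q)` per walk step, as `reflectZero` uses a linear ladder of Toffoli
gates; the hypothesis on `Tv + Tc` absorbs them. -/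

theorem onWires_mulVec {k m : ℕ} (w : Fin k ↪ Fin m) (G : Matrix (Bits k) (Bits k) ℂ)
    (ψ : Bits m → ℂ) (x : Bits m) :
    (onWires w G *ᵥ ψ) x = ∑ z, G (fun j => x (w j)) z * ψ (extend w z x) := by
  classical
  symm
  -- In row `x` only columns agreeing with `x` off the wires are nonzero; `z ↦ extend w z x`
  -- parametrises them.
  apply Fintype.sum_of_injective (fun z : Bits k => extend w z x)
  · intro a b h
    funext j
    simpa [w.injective.extend_apply] using congrFun h (w j)
  · intro y hy
    simp only [onWires, of_apply]
    rw [if_neg, zero_mul]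
    intro h
    refine hy ⟨fun j => y (w j), ?_⟩
    funext i
    by_cases hi : ∃ j, w j = i
    · obtain ⟨j, rfl⟩ := hi
      simp [w.injective.extend_apply]
    · simpa [extend_apply' _ _ _ hi] using h i (by simpa using hi)
  · intro z
    simp only [onWires, of_apply, w.injective.extend_apply]
    rw [if_pos]
    intro i hi
    rw [extend_apply' _ _ _ (by simpa using hi)]

theorem onWires_mulVec_mulVec {k m : ℕ} (w : Fin k ↪ Fin m) (G H : Matrix (Bits k) (Bits k) ℂ)
    (ψ : Bits m → ℂ) :
    onWires w G *ᵥ (onWires w H *ᵥ ψ) = onWires w (G * H) *ᵥ ψ := by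
  funext x
  have hx : ∀ z z' : Bits k, extend w z' (extend w z x) = extend w z' x := by
    intro z z'
    funext i
    by_cases hi : ∃ j, w j = i
    · obtain ⟨j, rfl⟩ := hi
      simp [w.injective.extend_apply]
    · simp [extend_apply' _ _ _ hi]
  simp only [onWires_mulVec, w.injective.extend_apply, hx, Matrix.mul_apply, Finset.mul_sum,
    Finset.sum_mul]
  rw [Finset.sum_comm]
  simp only [mul_assoc]

theorem onWires_mul {k m : ℕ} (w : Fin k ↪ Fin m) (G H : Matrix (Bits k) (Bits k) ℂ) :
    onWires w G * onWires w H = onWires w (G * H) := by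
  refine Matrix.mulVec_injective (funext fun ψ => ?_)
  rw [← Matrix.mulVec_mulVec, onWires_mulVec_mulVec]

theorem onWires_one {k m : ℕ} (w : Fin k ↪ Fin m) :
    onWires w (1 : Matrix (Bits k) (Bits k) ℂ) = 1 := by
  refine Matrix.mulVec_injective (funext fun ψ => funext fun x => ?_)
  have hx : extend w (fun j => x (w j)) x = x := by
    funext i
    by_cases hi : ∃ j, w j = i
    · obtain ⟨j, rfl⟩ := hi
      simp [w.injective.extend_apply]
    · simp [extend_apply' _ _ _ hi]
  simp [onWires_mulVec, Matrix.one_apply, hx]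

theorem onWires_conjTranspose {k m : ℕ} (w : Fin k ↪ Fin m) (G : Matrix (Bits k) (Bits k) ℂ) :
    (onWires w G)ᴴ = onWires w Gᴴ := by
  ext x y
  simp only [onWires, conjTranspose_apply, of_apply]
  by_cases h : ∀ i, i ∉ Set.range w → y i = x i
  · rw [if_pos h, if_pos fun i hi => (h i hi).symm]
  · rw [if_neg h, if_neg fun h' => h fun i hi => (h' i hi).symm, star_zero]

theorem onWires_mem_unitaryGroup {k m : ℕ} (w : Fin k ↪ Fin m) {G : Matrix (Bits k) (Bits k) ℂ}
    (hG : G ∈ unitaryGroup (Bits k) ℂ) : onWires w G ∈ unitaryGroup (Bits m) ℂ := by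
  rw [mem_unitaryGroup_iff, star_eq_conjTranspose] at *
  rw [onWires_conjTranspose, onWires_mul, hG, onWires_one]

theorem onWires_refl {k : ℕ} (G : Matrix (Bits k) (Bits k) ℂ) :
    onWires (Function.Embedding.refl _) G = G := by
  ext x y
  simp [onWires]

/-! ### Splitting off the control qubit; controlled operators and unitarity of gates -/

theorem sum_bits_succ {k : ℕ} {M : Type*} [AddCommMonoid M] (g : Bits (k + 1) → M) :
    ∑ x, g x = ∑ z : Bits k, g (Fin.cons true z) + ∑ z : Bits k, g (Fin.cons false z) := by
  rw [← (Fin.consEquiv fun _ => Bool).sum_comp g, Fintype.sum_prod_type]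
  simp [Fin.consEquiv]

theorem controlled_mulVec_true {k : ℕ} (G : Matrix (Bits k) (Bits k) ℂ) (ψ : Bits (k + 1) → ℂ)
    (z : Bits k) :
    (controlled G *ᵥ ψ) (Fin.cons true z) = (G *ᵥ fun y => ψ (Fin.cons true y)) z := by
  simp [mulVec, dotProduct, sum_bits_succ, controlled]

theorem controlled_mulVec_false {k : ℕ} (G : Matrix (Bits k) (Bits k) ℂ) (ψ : Bits (k + 1) → ℂ)
    (z : Bits k) :
    (controlled G *ᵥ ψ) (Fin.cons false z) = ψ (Fin.cons false z) := by
  simp [mulVec, dotProduct, sum_bits_succ, controlled, Matrix.one_apply]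

theorem bits_cases {k : ℕ} {p : Bits (k + 1) → Prop} (ht : ∀ z, p (Fin.cons true z))
    (hf : ∀ z, p (Fin.cons false z)) (x : Bits (k + 1)) : p x := by
  induction x using Fin.consCases with
  | cons b z => cases b <;> simp [ht, hf]

theorem controlled_mul {k : ℕ} (G H : Matrix (Bits k) (Bits k) ℂ) :
    controlled G * controlled H = controlled (G * H) := by
  refine Matrix.mulVec_injective (funext fun ψ => funext fun x => ?_)
  rw [← Matrix.mulVec_mulVec]
  induction x using bits_cases with
  | ht z => simp only [controlled_mulVec_true, ← Matrix.mulVec_mulVec]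
  | hf z => simp only [controlled_mulVec_false]

theorem controlled_one {k : ℕ} : controlled (1 : Matrix (Bits k) (Bits k) ℂ) = 1 := by
  refine Matrix.mulVec_injective (funext fun ψ => funext fun x => ?_)
  induction x using bits_cases with
  | ht z => simp only [controlled_mulVec_true, Matrix.one_mulVec]
  | hf z => simp only [controlled_mulVec_false, Matrix.one_mulVec]

theorem controlled_conjTranspose {k : ℕ} (G : Matrix (Bits k) (Bits k) ℂ) :
    (controlled G)ᴴ = controlled Gᴴ := by
  have h (a b : Bits k) : star ((1 : Matrix (Bits k) (Bits k) ℂ) a b) =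
      (1 : Matrix (Bits k) (Bits k) ℂ) b a :=
    congrFun (congrFun (conjTranspose_one (n := Bits k) (α := ℂ)) b) a
  ext x y
  rw [conjTranspose_apply]
  induction x using bits_cases <;> induction y using bits_cases <;> simp [controlled, h]

theorem controlled_mem_unitaryGroup {k : ℕ} {G : Matrix (Bits k) (Bits k) ℂ}
    (hG : G ∈ unitaryGroup (Bits k) ℂ) : controlled G ∈ unitaryGroup (Bits (k + 1)) ℂ := by
  rw [mem_unitaryGroup_iff, star_eq_conjTranspose] at *
  rw [controlled_conjTranspose, controlled_mul, hG, controlled_one]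

theorem oracleMatrix_mem_unitaryGroup {q : ℕ} (Uv Uc : unitaryGroup (Bits q) ℂ) (o : OracleName)
    (inv : Bool) : oracleMatrix Uv Uc o inv ∈ unitaryGroup (Bits q) ℂ := by
  cases o <;> cases inv <;> simp only [oracleMatrix, if_true, Bool.false_eq_true, if_false]
  exacts [Uv.2, Unitary.star_mem Uv.2, Uc.2, Unitary.star_mem Uc.2]

theorem Gate.matrix_mem_unitaryGroup {q m : ℕ} (Uv Uc : unitaryGroup (Bits q) ℂ) (g : Gate q m) :
    g.matrix Uv Uc ∈ unitaryGroup (Bits m) ℂ := by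
  cases g with
  | one G w => exact onWires_mem_unitaryGroup _ G.2
  | two G w => exact onWires_mem_unitaryGroup _ G.2
  | oracle o inv w => exact onWires_mem_unitaryGroup _ (oracleMatrix_mem_unitaryGroup _ _ _ _)
  | ctrlOracle o inv w =>
    exact onWires_mem_unitaryGroup _
      (controlled_mem_unitaryGroup (oracleMatrix_mem_unitaryGroup _ _ _ _))

/-! ### One-qubit gates and their controlled versions -/

/-- A matrix indexed by `Bool` as a one-qubit operator. -/
def oneQubit (M : Matrix Bool Bool ℂ) : Matrix (Bits 1) (Bits 1) ℂ :=
  M.submatrix (fun x => x 0) fun x => x 0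

theorem sum_bits_one {M : Type*} [AddCommMonoid M] (g : Bits 1 → M) :
    ∑ x, g x = ∑ s : Bool, g fun _ => s :=
  ((Equiv.funUnique (Fin 1) Bool).symm.sum_comp g).symm

theorem oneQubit_mem_unitaryGroup {M : Matrix Bool Bool ℂ} (hM : M ∈ unitaryGroup Bool ℂ) :
    oneQubit M ∈ unitaryGroup (Bits 1) ℂ := by
  rw [mem_unitaryGroup_iff, star_eq_conjTranspose] at *
  have h : oneQubit M * (oneQubit M)ᴴ = oneQubit (M * Mᴴ) := by
    ext x y
    simp [oneQubit, Matrix.mul_apply, sum_bits_one]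
  rw [h, hM]
  ext x y
  simp [oneQubit, Matrix.one_apply, funext_iff]

/-- The one-wire embedding. -/
def wire {m : ℕ} (t : Fin m) : Fin 1 ↪ Fin m := ⟨fun _ => t, fun _ _ _ => Subsingleton.elim _ _⟩

/-- The two-wire embedding. -/
def wires {m : ℕ} (a t : Fin m) (h : a ≠ t) : Fin 2 ↪ Fin m :=
  ⟨![a, t], by
    intro i j
    fin_cases i <;> fin_cases j <;> simp [h, h.symm]⟩

theorem extend_wire {m : ℕ} (t : Fin m) (s : Bool) (x : Bits m) :
    extend (wire t) (fun _ => s) x = update x t s := by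
  funext i
  by_cases hi : i = t
  · subst hi
    rw [update_self]
    exact (wire i).injective.extend_apply (fun _ => s) x 0
  · rw [update_of_ne hi, extend_apply']
    rintro ⟨j, hj⟩
    exact hi hj.symm

theorem oneQubit_mulVec {m : ℕ} (M : Matrix Bool Bool ℂ) (t : Fin m) (ψ : Bits m → ℂ)
    (x : Bits m) :
    (onWires (wire t) (oneQubit M) *ᵥ ψ) x = ∑ s, M (x t) s * ψ (update x t s) := by
  rw [onWires_mulVec, sum_bits_one]
  simp only [extend_wire]
  rfl

theorem extend_wires {m : ℕ} (a t : Fin m) (h : a ≠ t) (z : Bits 2) (x : Bits m) :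
    extend (wires a t h) z x = update (update x a (z 0)) t (z 1) := by
  funext i
  by_cases hi : i = t
  · subst hi
    rw [update_self]
    exact (wires a i h).injective.extend_apply z x 1
  · rw [update_of_ne hi]
    by_cases hi' : i = a
    · subst hi'
      rw [update_self]
      exact (wires i t h).injective.extend_apply z x 0
    · rw [update_of_ne hi', extend_apply']
      rintro ⟨j, hj⟩
      revert hj
      fin_cases j <;> simp [wires] <;> tauto

theorem controlled_oneQubit_mulVec {m : ℕ} (M : Matrix Bool Bool ℂ) (a t : Fin m) (h : a ≠ t)
    (ψ : Bits m → ℂ) (x : Bits m) :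
    (onWires (wires a t h) (controlled (oneQubit M)) *ᵥ ψ) x =
      if x a = true then ∑ s, M (x t) s * ψ (update x t s) else ψ x := by
  have h0 : (fun j => x (wires a t h j)) = Fin.cons (x a) (fun _ => x t) := by
    funext j
    fin_cases j <;> rfl
  rw [onWires_mulVec, h0, sum_bits_succ, sum_bits_one, sum_bits_one]
  simp only [extend_wires, Fin.cons_zero, Fin.cons_one]
  cases hx : x a
  · have hxa : update x a false = x := by rw [← hx, update_eq_self]
    have hxt : update x t (x t) = x := update_eq_self _ _
    cases ht : x t <;> rw [ht] at hxt <;>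
      simp [controlled, Matrix.one_apply, hxa, hxt, funext_iff]
  · have hxa : update x a true = x := by rw [← hx, update_eq_self]
    simp [controlled, hxa, oneQubit]

end QAlg

noncomputable section

namespace QAlg

open Matrix Function

/-! ### A library of elementary gates -/

theorem oneQubit_conjTranspose (M : Matrix Bool Bool ℂ) : (oneQubit M)ᴴ = oneQubit Mᴴ := rfl

/-- The one-qubit gate with the given matrix on wire `t`. -/
def oneGate {q m : ℕ} (M : unitaryGroup Bool ℂ) (t : Fin m) : Gate q m :=
  .one ⟨oneQubit M, oneQubit_mem_unitaryGroup M.2⟩ (wire t)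

/-- The controlled one-qubit gate with the given matrix, control `a` and target `t`. -/
def ctrlGate {q m : ℕ} (M : unitaryGroup Bool ℂ) (a t : Fin m) (h : a ≠ t) : Gate q m :=
  .two ⟨controlled (oneQubit M), controlled_mem_unitaryGroup (oneQubit_mem_unitaryGroup M.2)⟩
    (wires a t h)

/-- The unitary `!![a, b; b, a]`. -/
def symmetricGate (a b : ℂ) (h : a * star a + b * star b = 1) (h' : a * star b + b * star a = 0) :
    unitaryGroup Bool ℂ :=
  ⟨Matrix.of fun x y => if x = y then a else b, by
    rw [mem_unitaryGroup_iff, star_eq_conjTranspose]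
    ext x y
    have h2 : b * star a + a * star b = 0 := by rw [add_comm, h']
    have h3 : b * star b + a * star a = 1 := by rw [add_comm, h]
    cases x <;> cases y <;>
      simp only [Matrix.mul_apply, Fintype.sum_bool, conjTranspose_apply, of_apply,
        Matrix.one_apply, reduceCtorEq, if_true, if_false] <;> assumption⟩

/-- The Pauli `X` gate. -/
def notGate : unitaryGroup Bool ℂ := symmetricGate 0 1 (by simp) (by simp)

/-- A square root of the Pauli `X` gate. -/
def sqrtNotGate : unitaryGroup Bool ℂ :=
  symmetricGate ((1 + Complex.I) / 2) ((1 - Complex.I) / 2)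
    (by apply Complex.ext <;> simp <;> norm_num) (by apply Complex.ext <;> simp <;> norm_num)

/-- The inverse of `sqrtNotGate`. -/
def sqrtNotInvGate : unitaryGroup Bool ℂ :=
  symmetricGate ((1 - Complex.I) / 2) ((1 + Complex.I) / 2)
    (by apply Complex.ext <;> simp <;> norm_num) (by apply Complex.ext <;> simp <;> norm_num)

theorem inv_sqrt_two_mul_self : ((√2 : ℝ) : ℂ)⁻¹ * ((√2 : ℝ) : ℂ)⁻¹ = 1 / 2 := by
  rw [← mul_inv, ← Complex.ofReal_mul, Real.mul_self_sqrt (by norm_num)]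
  norm_num

/-- The Hadamard gate. -/
def hadamardGate : unitaryGroup Bool ℂ :=
  ⟨Matrix.of fun x y => if (x && y) = true then -((√2 : ℝ) : ℂ)⁻¹ else ((√2 : ℝ) : ℂ)⁻¹, by
    rw [mem_unitaryGroup_iff, star_eq_conjTranspose]
    ext x y
    cases x <;> cases y <;> norm_num [Matrix.mul_apply, inv_sqrt_two_mul_self]⟩

/-- The gate `|0⟩ ↦ -|0⟩`, `|1⟩ ↦ |1⟩`. -/
def signGate : unitaryGroup Bool ℂ :=
  ⟨Matrix.diagonal fun x => if x = true then 1 else -1, by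
    rw [mem_unitaryGroup_iff, star_eq_conjTranspose]
    ext x y
    cases x <;> cases y <;> simp [Matrix.mul_apply]⟩

/-- The gate `|1⟩ ↦ u |0⟩`, `|0⟩ ↦ |1⟩`. -/
def phaseSwapGate (u : ℂ) (hu : ‖u‖ = 1) : unitaryGroup Bool ℂ :=
  ⟨Matrix.of fun x y => if x = y then 0 else if x = true then 1 else u, by
    rw [mem_unitaryGroup_iff, star_eq_conjTranspose]
    ext x y
    cases x <;> cases y <;> simp [Matrix.mul_apply, Complex.mul_conj', hu]⟩

/-- The effect of a circuit on an arbitrary state. -/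
def Circuit.run {q m : ℕ} (Uv Uc : unitaryGroup (Bits q) ℂ) (K : Circuit q m) (ψ : Bits m → ℂ) :
    Bits m → ℂ :=
  K.foldl (fun ψ g => g.matrix Uv Uc *ᵥ ψ) ψ

section

variable {q m : ℕ} (Uv Uc : unitaryGroup (Bits q) ℂ)

theorem Circuit.run_nil (ψ : Bits m → ℂ) : Circuit.run Uv Uc ([] : Circuit q m) ψ = ψ := rfl

theorem Circuit.run_cons (g : Gate q m) (K : Circuit q m) (ψ : Bits m → ℂ) :
    Circuit.run Uv Uc (g :: K) ψ = Circuit.run Uv Uc K (g.matrix Uv Uc *ᵥ ψ) := rfl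

theorem Circuit.run_append (K L : Circuit q m) (ψ : Bits m → ℂ) :
    Circuit.run Uv Uc (K ++ L) ψ = Circuit.run Uv Uc L (Circuit.run Uv Uc K ψ) :=
  List.foldl_append

theorem Circuit.state_eq_run (K : Circuit q m) :
    K.state Uv Uc = Circuit.run Uv Uc K (zeroState m) := rfl

theorem notGate_mulVec (t : Fin m) (ψ : Bits m → ℂ) :
    (oneGate notGate t : Gate q m).matrix Uv Uc *ᵥ ψ = fun x => ψ (update x t (!x t)) := by
  funext x
  change (onWires _ _ *ᵥ ψ) x = _
  rw [oneQubit_mulVec]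
  cases h : x t <;> simp [notGate, symmetricGate]

theorem ctrlNotGate_mulVec (a t : Fin m) (h : a ≠ t) (ψ : Bits m → ℂ) :
    (ctrlGate notGate a t h : Gate q m).matrix Uv Uc *ᵥ ψ =
      fun x => if x a = true then ψ (update x t (!x t)) else ψ x := by
  funext x
  change (onWires _ _ *ᵥ ψ) x = _
  rw [controlled_oneQubit_mulVec]
  cases h : x t <;> simp [notGate, symmetricGate]

theorem signGate_mulVec (t : Fin m) (ψ : Bits m → ℂ) :
    (oneGate signGate t : Gate q m).matrix Uv Uc *ᵥ ψ =
      fun x => (if x t = true then 1 else -1) * ψ x := by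
  funext x
  change (onWires _ _ *ᵥ ψ) x = _
  have hx : update x t (x t) = x := update_eq_self _ _
  rw [oneQubit_mulVec]
  cases h : x t <;> rw [h] at hx <;> simp [signGate, hx, Matrix.diagonal]

/-- The Toffoli gate with controls `a`, `b` and target `t`. -/
def toffoli {a b t : Fin m} (hab : a ≠ b) (hat : a ≠ t) (hbt : b ≠ t) : Circuit q m :=
  [ctrlGate sqrtNotGate b t hbt, ctrlGate notGate a b hab, ctrlGate sqrtNotInvGate b t hbt,
    ctrlGate notGate a b hab, ctrlGate sqrtNotGate a t hat]

theorem ctrlGate_mulVec (M : unitaryGroup Bool ℂ) (a t : Fin m) (h : a ≠ t) (ψ : Bits m → ℂ) :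
    (ctrlGate M a t h : Gate q m).matrix Uv Uc *ᵥ ψ =
      fun x => if x a = true then
        M.1 (x t) true * ψ (update x t true) + M.1 (x t) false * ψ (update x t false) else ψ x := by
  funext x
  change (onWires _ _ *ᵥ ψ) x = _
  rw [controlled_oneQubit_mulVec]
  simp

/-- With `V² = X`, the target receives `V` to the power `b - (a xor b) + a = 2ab`, that is, `X`
exactly when both controls are set. -/
theorem toffoli_run {a b t : Fin m} (hab : a ≠ b) (hat : a ≠ t) (hbt : b ≠ t) (ψ : Bits m → ℂ) :
    Circuit.run Uv Uc (toffoli hab hat hbt) ψ = fun x => ψ (update x t (x t ^^ (x a && x b))) := by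
  simp only [toffoli, Circuit.run_cons, Circuit.run_nil, ctrlNotGate_mulVec]
  simp only [ctrlGate_mulVec]
  funext x
  have hx : update x t (x t) = x := update_eq_self _ _
  have hxb : update x b (x b) = x := update_eq_self _ _
  have e (s : Bool) : update (update x t s) b (x b) = update x t s := by
    rw [update_comm hbt.symm, hxb]
  cases ha : x a <;> cases hb : x b <;> cases ht : x t <;> rw [ht] at hx <;> rw [hb] at hxb e <;>
    simp [ha, hb, ht, hab, hat, hbt, hbt.symm, hx, hxb, e, update_comm hbt,
      sqrtNotGate, sqrtNotInvGate, symmetricGate] <;> ring_nf <;>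
    simp [Complex.I_sq] <;> ring_nf

end

end QAlg

end

noncomputable section

namespace QAlg

open Matrix Function

/-! ### Adjoining ancilla qubits -/

/-- The state `ψ ⊗ |0…0⟩` with `r` ancilla qubits. -/
def pad {k : ℕ} (r : ℕ) (ψ : Bits k → ℂ) : Bits (k + r) → ℂ :=
  fun x => if ∀ i, x (Fin.natAdd k i) = false then ψ fun i => x (Fin.castAdd r i) else 0

theorem pad_zeroState (k r : ℕ) : pad r (zeroState k) = zeroState (k + r) := by
  funext x
  simp only [pad, zeroState, Pi.single_apply, ← ite_and]
  congr 1
  rw [eq_iff_iff, funext_iff, funext_iff, Fin.forall_fin_add]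
  exact And.comm

/-- Gates on the first block leave the ancillas alone, so their effect can be computed on the
unpadded register. -/
theorem onWires_pad {k l : ℕ} (r : ℕ) (w : Fin l ↪ Fin k) (G : Matrix (Bits l) (Bits l) ℂ)
    (ψ : Bits k → ℂ) :
    onWires (w.trans (Fin.castAddEmb r)) G *ᵥ pad r ψ = pad r (onWires w G *ᵥ ψ) := by
  funext x
  have h1 (z : Bits l) (i : Fin r) :
      extend (w.trans (Fin.castAddEmb r)) z x (Fin.natAdd k i) = x (Fin.natAdd k i) := by
    rw [extend_apply']
    rintro ⟨j, hj⟩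
    have := congrArg Fin.val hj
    simp at this
    omega
  have h2 (z : Bits l) : (fun i => extend (w.trans (Fin.castAddEmb r)) z x (Fin.castAdd r i)) =
      extend w z fun i => x (Fin.castAdd r i) := by
    funext i
    by_cases hi : ∃ j, w j = i
    · obtain ⟨j, rfl⟩ := hi
      rw [w.injective.extend_apply]
      exact (w.trans (Fin.castAddEmb r)).injective.extend_apply z x j
    · rw [extend_apply' _ _ _ hi, extend_apply']
      rintro ⟨j, hj⟩
      exact hi ⟨j, Fin.castAdd_injective _ _ hj⟩
  rw [onWires_mulVec]
  simp only [pad, h1, h2]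
  split_ifs with h
  · rw [onWires_mulVec]
    rfl
  · simp

theorem sum_norm_sq_pad {k r : ℕ} (p : Bits k → Prop) [DecidablePred p] (ψ : Bits k → ℂ) :
    ∑ x : Bits (k + r), (if p fun i => x (Fin.castAdd r i) then ‖pad r ψ x‖ ^ 2 else 0) =
      ∑ y : Bits k, if p y then ‖ψ y‖ ^ 2 else 0 := by
  symm
  apply Fintype.sum_of_injective fun y : Bits k => (Fin.append y fun _ : Fin r => false)
  · intro a b h
    funext i
    simpa using congrFun h (Fin.castAdd r i)
  · intro x hx
    have : pad r ψ x = 0 := by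
      rw [pad, if_neg]
      intro h
      refine hx ⟨fun i => x (Fin.castAdd r i), ?_⟩
      funext i
      induction i using Fin.addCases with
      | left i => simp
      | right i => simp [h]
    simp [this]
  · intro y
    simp [pad]

/-! ### The reflection about the zero state -/

section

variable {q : ℕ} (Uv Uc : unitaryGroup (Bits q) ℂ)

/-- Compute, apply a diagonal operator, uncompute: as each `τ i` is an involution, the mirrored
second half undoes the first, and only the diagonal entry at the computed basis state remains. -/
theorem conjugation_run {m : ℕ} {ι : Type*} (L : List ι) (T : ι → Circuit q m)
    (τ : ι → Bits m → Bits m) (hτ : ∀ i x, τ i (τ i x) = x)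
    (hT : ∀ i ψ, Circuit.run Uv Uc (T i) ψ = fun x => ψ (τ i x)) (D : Circuit q m)
    (f : Bits m → ℂ) (hD : ∀ ψ, Circuit.run Uv Uc D ψ = fun x => f x * ψ x) (ψ : Bits m → ℂ) :
    Circuit.run Uv Uc (L.foldr (fun i K => T i ++ K ++ T i) D) ψ =
      fun x => f (L.foldl (fun y i => τ i y) x) * ψ x := by
  induction L generalizing ψ with
  | nil => exact hD ψ
  | cons i L ih =>
    rw [List.foldr_cons, Circuit.run_append, Circuit.run_append, hT, ih, hT]
    simp [hτ]

/-- The number of wires of the estimation circuit: a control qubit, `q` system qubits, and `q + 2`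
ancillas. -/
abbrev width (q : ℕ) : ℕ := q + 1 + (q + 2)

/-- The wires on which the reflection acts. -/
def sysWire (i : Fin (q + 1)) : Fin (width q) := Fin.castAdd (q + 2) i

/-- The ancilla wires. -/
def ancWire (i : Fin (q + 2)) : Fin (width q) := Fin.natAdd (q + 1) i

theorem sysWire_ne_ancWire (i : Fin (q + 1)) (j : Fin (q + 2)) : sysWire i ≠ ancWire j := by
  intro h
  have := congrArg Fin.val h
  simp [sysWire, ancWire] at this
  omega

theorem ancWire_injective : Injective (ancWire (q := q)) := Fin.natAdd_injective _ _

theorem ancWire_castSucc_ne_succ (i : Fin (q + 1)) :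
    ancWire i.castSucc ≠ ancWire i.succ := fun h =>
  Fin.castSucc_lt_succ.ne (ancWire_injective h)

/-- Adds the conjunction of an ancilla and a negated system bit to the next ancilla. -/
def ladderStep (i : Fin (q + 1)) : Circuit q (width q) :=
  oneGate notGate (sysWire i) ::
    (toffoli (sysWire_ne_ancWire i i.castSucc) (sysWire_ne_ancWire i i.succ)
      (ancWire_castSucc_ne_succ i) ++ [oneGate notGate (sysWire i)])

/-- The effect of `ladderStep` on the computational basis. -/
def ladderMap (i : Fin (q + 1)) (x : Bits (width q)) : Bits (width q) :=
  update x (ancWire i.succ) (x (ancWire i.succ) ^^ (!x (sysWire i) && x (ancWire i.castSucc)))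

theorem ladderStep_run (i : Fin (q + 1)) (ψ : Bits (width q) → ℂ) :
    Circuit.run Uv Uc (ladderStep i) ψ = fun x => ψ (ladderMap i x) := by
  rw [ladderStep, Circuit.run_cons, notGate_mulVec, Circuit.run_append, toffoli_run,
    Circuit.run_cons, notGate_mulVec, Circuit.run_nil]
  funext x
  have h1 := sysWire_ne_ancWire i i.castSucc
  have h2 := sysWire_ne_ancWire i i.succ
  simp [ladderMap, h1.symm, h2, h2.symm, update_comm h2]
  rw [update_comm h2.symm, update_eq_self]

theorem ladderMap_ladderMap (i : Fin (q + 1)) (x : Bits (width q)) :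
    ladderMap i (ladderMap i x) = x := by
  simp [ladderMap, sysWire_ne_ancWire, ancWire_castSucc_ne_succ]

theorem foldl_ladderMap (x : Bits (width q)) (h0 : x (ancWire 0) = true)
    (h : ∀ i : Fin (q + 1), x (ancWire i.succ) = false) :
    (List.finRange (q + 1)).foldl (fun y i => ladderMap i y) x (ancWire (Fin.last (q + 1))) =
      decide (∀ i, x (sysWire i) = false) := by
  -- Invariant after `j` steps: system bits unchanged, ancillas beyond `j` still clear, and ancilla
  -- `j` holds the conjunction of the first `j` negated system bits. Ancilla `0`, set to `true`, is
  -- the empty conjunction.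
  suffices H : ∀ j : ℕ, j ≤ q + 1 →
      let y := ((List.finRange (q + 1)).take j).foldl (fun y i => ladderMap i y) x
      (∀ i, y (sysWire i) = x (sysWire i)) ∧
      (∀ i : Fin (q + 1), j < i.val + 1 → y (ancWire i.succ) = false) ∧
      ∀ i : Fin (q + 2), i.val = j →
        y (ancWire i) = decide (∀ k : Fin (q + 1), k.val < j → x (sysWire k) = false) by
    have := (H (q + 1) le_rfl).2.2 (Fin.last _) rfl
    rw [List.take_of_length_le (by simp)] at this
    rw [this]
    simp only [Fin.is_lt, forall_const]
  intro j
  induction j with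
  | zero =>
    intro _
    refine ⟨fun _ => rfl, fun i _ => h i, fun i hi => ?_⟩
    obtain rfl : i = 0 := Fin.ext hi
    simpa using h0
  | succ j ih =>
    intro hj
    obtain ⟨h1, h2, h3⟩ := ih (by omega)
    have hlt : j < (List.finRange (q + 1)).length := by simpa using hj
    simp only [← List.take_concat_get' _ _ hlt, List.foldl_append, List.foldl_cons, List.foldl_nil,
      List.getElem_finRange, Fin.cast_mk]
    set y := ((List.finRange (q + 1)).take j).foldl (fun y i => ladderMap i y) x with hy
    refine ⟨fun i => ?_, fun i hi => ?_, fun i hi => ?_⟩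
    · rw [ladderMap, update_of_ne (sysWire_ne_ancWire _ _), h1]
    · rw [ladderMap, update_of_ne, h2 i (by omega)]
      intro h'
      have := congrArg Fin.val (ancWire_injective h')
      simp at this
      omega
    · rw [show i = Fin.succ ⟨j, by omega⟩ from Fin.ext hi]
      rw [ladderMap, update_self, h2 _ (by simp), h1, h3 _ rfl]
      rw [Bool.false_xor, Bool.eq_iff_iff]
      simp only [Bool.and_eq_true, Bool.not_eq_true', decide_eq_true_eq]
      constructor
      · rintro ⟨ha, hb⟩ k hk
        rcases Nat.lt_succ_iff_lt_or_eq.1 hk with hk | hk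
        · exact hb k hk
        · rw [show k = ⟨j, by omega⟩ from Fin.ext hk]
          exact ha
      · intro ha
        exact ⟨ha _ (Nat.lt_succ_self _), fun k hk => ha k (Nat.lt_succ_of_lt hk)⟩

/-- The reflection `2 |0⟩⟨0| - 1` on the control and system qubits. -/
def reflectZero (q : ℕ) : Circuit q (width q) :=
  oneGate notGate (ancWire 0) ::
    ((List.finRange (q + 1)).foldr (fun i K => ladderStep i ++ K ++ ladderStep i)
      [oneGate signGate (ancWire (Fin.last (q + 1)))] ++ [oneGate notGate (ancWire 0)])

/-- The ladder writes "all bits are zero" into the last ancilla, `signGate` negates the amplitude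
when this fails, and the mirrored ladder clears the ancillas again. -/
theorem reflectZero_run (ψ : Bits (q + 1) → ℂ) :
    Circuit.run Uv Uc (reflectZero q) (pad (q + 2) ψ) =
      pad (q + 2) (fun z => (if ∀ i, z i = false then 1 else -1) * ψ z) := by
  rw [reflectZero, Circuit.run_cons, notGate_mulVec, Circuit.run_append,
    conjugation_run Uv Uc _ ladderStep ladderMap ladderMap_ladderMap (ladderStep_run Uv Uc) _
      (fun x => if x (ancWire (Fin.last (q + 1))) = true then 1 else -1)
      (fun φ => by rw [Circuit.run_cons, signGate_mulVec, Circuit.run_nil]),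
    Circuit.run_cons, notGate_mulVec, Circuit.run_nil]
  funext x
  simp only [update_idem, update_self, Bool.not_not, update_eq_self]
  by_cases hx : ∀ i : Fin (q + 2), x (ancWire i) = false
  · have hpad (φ : Bits (q + 1) → ℂ) : pad (q + 2) φ x = φ fun i => x (sysWire i) := if_pos hx
    rw [foldl_ladderMap, hpad, hpad]
    · simp only [update_of_ne (sysWire_ne_ancWire _ _), decide_eq_true_eq]
    · simp [hx]
    · intro i
      rw [update_of_ne, hx]
      exact fun h => Fin.succ_ne_zero i (ancWire_injective h)
  · have hpad (φ : Bits (q + 1) → ℂ) : pad (q + 2) φ x = 0 := if_neg hx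
    rw [hpad, hpad, mul_zero]

theorem reflectZero_run_eq (ψ : Bits (q + 1) → ℂ) :
    Circuit.run Uv Uc (reflectZero q) (pad (q + 2) ψ) =
      pad (q + 2) ((2 * (star (zeroState (q + 1)) ⬝ᵥ ψ)) • zeroState (q + 1) - ψ) := by
  rw [reflectZero_run]
  congr 1
  funext z
  have h : star (zeroState (q + 1)) ⬝ᵥ ψ = ψ fun _ => false := by
    simp [zeroState, dotProduct, Pi.single_apply]
  rw [h]
  simp only [zeroState, Pi.sub_apply, Pi.smul_apply, Pi.single_apply, smul_eq_mul]
  by_cases hz : ∀ i, z i = false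
  · obtain rfl : z = fun _ => false := funext hz
    simp
    ring
  · rw [if_neg hz, if_neg fun h => hz (congrFun h)]
    ring

end

end QAlg

end

noncomputable section

namespace QAlg

open Matrix Function

/-! ### Rotation by a pair of reflections -/

open scoped ComplexOrder in
-- Gram–Schmidt applied to `χ`, `X χ`, whose span is invariant as `X` is an involution. If `sin φ =
-- 0` the span is a line, and `f = 0` keeps the formulas uniform.
theorem exists_rotation_basis {ι : Type*} [Fintype ι] (X : Matrix ι ι ℂ)
    (hXX : ∀ ψ, X *ᵥ (X *ᵥ ψ) = ψ) (hX : Xᴴ = X) (χ : ι → ℂ) (hχ : star χ ⬝ᵥ χ = 1) (φ : ℝ)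
    (hφ : star χ ⬝ᵥ (X *ᵥ χ) = (Real.cos φ : ℂ)) :
    ∃ f : ι → ℂ, X *ᵥ χ = (Real.cos φ : ℂ) • χ + (Real.sin φ : ℂ) • f ∧
      X *ᵥ f = (Real.sin φ : ℂ) • χ - (Real.cos φ : ℂ) • f ∧ star χ ⬝ᵥ f = 0 ∧ star f ⬝ᵥ χ = 0 ∧
      (star f ⬝ᵥ f = 1 ∨ f = 0 ∧ Real.sin φ = 0) := by
  set e := X *ᵥ χ with he
  have hXe : X *ᵥ e = χ := hXX χ
  have hee : star e ⬝ᵥ e = 1 := by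
    rw [he, star_mulVec, hX, ← dotProduct_mulVec, hXX, hχ]
  have heχ : star e ⬝ᵥ χ = (Real.cos φ : ℂ) := by
    rw [he, star_mulVec, hX, ← dotProduct_mulVec, hφ]
  have hcs : (Real.cos φ : ℂ) * Real.cos φ + (Real.sin φ : ℂ) * Real.sin φ = 1 := by
    rw [← Complex.ofReal_mul, ← Complex.ofReal_mul, ← Complex.ofReal_add]
    rw [← sq, ← sq, Real.cos_sq_add_sin_sq, Complex.ofReal_one]
  have hstar (c : ℝ) : star (c : ℂ) = c := Complex.conj_ofReal c
  set c : ℂ := (Real.cos φ : ℂ) with hc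
  have hsc : star c = c := hstar _
  have hg : star (e - c • χ) ⬝ᵥ (e - c • χ) = (Real.sin φ : ℂ) * Real.sin φ := by
    simp only [star_sub, star_smul, hsc, sub_dotProduct, dotProduct_sub, smul_dotProduct,
      dotProduct_smul, hee, heχ, hφ, hχ, smul_eq_mul]
    linear_combination -hcs
  by_cases hs : Real.sin φ = 0
  · have h0 : e - c • χ = 0 := by
      rw [← dotProduct_star_self_eq_zero (R := ℂ), hg, hs]
      simp
    have h1 : e = c • χ := sub_eq_zero.1 h0
    exact ⟨0, by simp [h1], by simp [hs], by simp, by simp, Or.inr ⟨rfl, hs⟩⟩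
  · have hs' : (Real.sin φ : ℂ) ≠ 0 := Complex.ofReal_ne_zero.2 hs
    have hss : star (Real.sin φ : ℂ) = Real.sin φ := hstar _
    set s : ℂ := (Real.sin φ : ℂ) with hsdef
    have hsi : star s⁻¹ = s⁻¹ := by rw [star_inv₀, hss]
    refine ⟨s⁻¹ • (e - c • χ), ?_, ?_, ?_, ?_, Or.inl ?_⟩
    · rw [smul_inv_smul₀ hs']
      abel
    · rw [mulVec_smul, mulVec_sub, mulVec_smul, hXe, ← he]
      funext i
      simp only [Pi.smul_apply, Pi.sub_apply, smul_eq_mul]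
      field_simp
      linear_combination (-χ i) * hcs
    · simp only [dotProduct_smul, dotProduct_sub, hφ, hχ, smul_eq_mul]
      ring
    · simp only [star_smul, star_sub, hsc, smul_dotProduct, sub_dotProduct, heχ, hχ, smul_eq_mul]
      ring
    · rw [star_smul, smul_dotProduct, dotProduct_smul, hg, hsi]
      simp only [smul_eq_mul]
      field_simp

/-- The walk `ψ ↦ (2|χ⟩⟨χ| - 1) X ψ`, iterated. -/
def walk {ι : Type*} [Fintype ι] (X : Matrix ι ι ℂ) (χ : ι → ℂ) : ℕ → ι → ℂ
  | 0 => χ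
  | j + 1 => (2 * (star χ ⬝ᵥ (X *ᵥ walk X χ j))) • χ - X *ᵥ walk X χ j

/-- In the frame `χ, f`, step `j` of the walk sits at angle `-jφ` and its image under `X` at angle
`(j+1)φ`. They enclose the angle `(2j+1)φ`, which determines the norm of their sum. -/
theorem walk_norm {ι : Type*} [Fintype ι] (X : Matrix ι ι ℂ)
    (hXX : ∀ ψ, X *ᵥ (X *ᵥ ψ) = ψ) (hX : Xᴴ = X) (χ : ι → ℂ) (hχ : star χ ⬝ᵥ χ = 1) (φ : ℝ)
    (hφ : star χ ⬝ᵥ (X *ᵥ χ) = (Real.cos φ : ℂ)) (j : ℕ) :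
    star (walk X χ j + X *ᵥ walk X χ j) ⬝ᵥ (walk X χ j + X *ᵥ walk X χ j) =
      ((2 + 2 * Real.cos ((2 * j + 1) * φ) : ℝ) : ℂ) := by
  obtain ⟨f, h1, h2, h3, h3', h4⟩ := exists_rotation_basis X hXX hX χ hχ φ hφ
  have hw (j : ℕ) :
      walk X χ j = (Real.cos (j * φ) : ℂ) • χ - (Real.sin (j * φ) : ℂ) • f ∧
      X *ᵥ walk X χ j = (Real.cos ((j + 1) * φ) : ℂ) • χ + (Real.sin ((j + 1) * φ) : ℂ) • f := by
    have hX' (j : ℕ) (h : walk X χ j = (Real.cos (j * φ) : ℂ) • χ - (Real.sin (j * φ) : ℂ) • f) :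
        X *ᵥ walk X χ j =
          (Real.cos ((j + 1) * φ) : ℂ) • χ + (Real.sin ((j + 1) * φ) : ℂ) • f := by
      rw [h, mulVec_sub, mulVec_smul, mulVec_smul, h1, h2, add_mul, one_mul, Real.cos_add,
        Real.sin_add]
      push_cast
      funext i
      simp only [Pi.smul_apply, Pi.sub_apply, Pi.add_apply, smul_eq_mul]
      ring
    induction j with
    | zero =>
      have h : walk X χ 0 =
          (Real.cos ((0 : ℕ) * φ) : ℂ) • χ - (Real.sin ((0 : ℕ) * φ) : ℂ) • f := by simp [walk]
      exact ⟨h, hX' 0 h⟩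
    | succ j ih =>
      have h : walk X χ (j + 1) = (Real.cos ((j + 1 : ℕ) * φ) : ℂ) • χ -
          (Real.sin ((j + 1 : ℕ) * φ) : ℂ) • f := by
        rw [walk, ih.2]
        simp only [dotProduct_add, dotProduct_smul, hχ, h3, smul_eq_mul, Nat.cast_add, Nat.cast_one]
        funext i
        simp only [Pi.smul_apply, Pi.sub_apply, Pi.add_apply, smul_eq_mul]
        ring
      exact ⟨h, hX' _ h⟩
  rw [(hw j).2, (hw j).1]
  set a := Real.cos (j * φ) with ha
  set b := Real.sin (j * φ) with hb
  set a' := Real.cos ((j + 1) * φ) with ha'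
  set b' := Real.sin ((j + 1) * φ) with hb'
  have hcos : Real.cos ((2 * j + 1) * φ) = a * a' - b * b' := by
    rw [ha, hb, ha', hb', ← Real.cos_add]
    ring_nf
  -- In the degenerate case `f = 0`, but `φ` is then a multiple of `π` and both sines vanish.
  have hf : star f ⬝ᵥ f * ((b' - b) * (b' - b) : ℂ) = (b' - b) * (b' - b) := by
    rcases h4 with h | ⟨-, h⟩
    · rw [h, one_mul]
    · obtain ⟨k, hk⟩ := Real.sin_eq_zero_iff.1 h
      have h5 : b = 0 := by
        rw [hb, ← hk, ← mul_assoc]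
        exact_mod_cast Real.sin_int_mul_pi (j * k)
      have h6 : b' = 0 := by
        rw [hb', ← hk, ← mul_assoc]
        exact_mod_cast Real.sin_int_mul_pi ((j + 1) * k)
      rw [h5, h6]
      simp
  have e1 : a * a + b * b = 1 := by rw [ha, hb, ← sq, ← sq, Real.cos_sq_add_sin_sq]
  have e2 : a' * a' + b' * b' = 1 := by rw [ha', hb', ← sq, ← sq, Real.cos_sq_add_sin_sq]
  have e1' : (a : ℂ) * a + b * b = 1 := by exact_mod_cast e1
  have e2' : (a' : ℂ) * a' + b' * b' = 1 := by exact_mod_cast e2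
  have hs (c : ℝ) : star (c : ℂ) = c := Complex.conj_ofReal c
  rw [hcos]
  simp only [star_add, star_sub, star_smul, hs, sub_dotProduct, dotProduct_sub, add_dotProduct,
    dotProduct_add, smul_dotProduct, dotProduct_smul, hχ, h3, h3', smul_eq_mul]
  push_cast
  linear_combination hf + e1' + e2'

end QAlg

end

noncomputable section

namespace QAlg

open Matrix Function

/-! ### The Hadamard-test state of two prepared vectors -/

section

variable {q : ℕ} (Uv Uc : unitaryGroup (Bits q) ℂ) (u : ℂ) (hu : ‖u‖ = 1)

theorem oneQubit_mulVec_cons (M : Matrix Bool Bool ℂ) (ψ : Bits (q + 1) → ℂ) (b : Bool)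
    (z : Bits q) :
    (onWires (wire 0) (oneQubit M) *ᵥ ψ) (Fin.cons b z) =
      M b true * ψ (Fin.cons true z) + M b false * ψ (Fin.cons false z) := by
  rw [oneQubit_mulVec]
  simp [Fin.update_cons_zero]

/-- The unitary `|0⟩|0⟩ ↦ (|1⟩|v⟩ + u |0⟩|c⟩) / √2`. -/
def prepMatrix : Matrix (Bits (q + 1)) (Bits (q + 1)) ℂ :=
  controlled Uv.1 * (onWires (wire 0) (oneQubit (phaseSwapGate u hu).1) *
    (controlled Uc.1 * onWires (wire 0) (oneQubit hadamardGate.1)))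

theorem prepMatrix_mul_conjTranspose :
    prepMatrix Uv Uc u hu * (prepMatrix Uv Uc u hu)ᴴ = 1 := by
  rw [← star_eq_conjTranspose, ← mem_unitaryGroup_iff]
  exact mul_mem (controlled_mem_unitaryGroup Uv.2)
    (mul_mem (onWires_mem_unitaryGroup _ (oneQubit_mem_unitaryGroup (Subtype.prop _)))
      (mul_mem (controlled_mem_unitaryGroup Uc.2)
        (onWires_mem_unitaryGroup _ (oneQubit_mem_unitaryGroup (Subtype.prop _)))))

theorem zeroState_cons (b : Bool) (z : Bits q) :
    zeroState (q + 1) (Fin.cons b z) = if b = true then 0 else zeroState q z := by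
  have h : (Fin.cons b z = fun _ : Fin (q + 1) => false) ↔ b = false ∧ z = fun _ => false := by
    simp [funext_iff, Fin.forall_fin_succ]
  simp only [zeroState, Pi.single_apply, h]
  cases b <;> simp

theorem star_zeroState_dotProduct_self (m : ℕ) : star (zeroState m) ⬝ᵥ zeroState m = 1 := by
  simp [zeroState, dotProduct, Pi.single_apply]

/-- The state `(|1⟩|v⟩ + u |0⟩|c⟩) / √2`. -/
def testState : Bits (q + 1) → ℂ := prepMatrix Uv Uc u hu *ᵥ zeroState (q + 1)

theorem testState_norm : star (testState Uv Uc u hu) ⬝ᵥ testState Uv Uc u hu = 1 := by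
  have h : (prepMatrix Uv Uc u hu)ᴴ * prepMatrix Uv Uc u hu = 1 :=
    mul_eq_one_comm.1 (prepMatrix_mul_conjTranspose Uv Uc u hu)
  rw [testState, star_mulVec, ← dotProduct_mulVec, mulVec_mulVec, h, one_mulVec,
    star_zeroState_dotProduct_self]

theorem hadamard_zeroState (b : Bool) (z : Bits q) :
    hadamardGate.1 b true * zeroState (q + 1) (Fin.cons true z) +
      hadamardGate.1 b false * zeroState (q + 1) (Fin.cons false z) =
      ((√2 : ℝ) : ℂ)⁻¹ * zeroState q z := by
  rw [zeroState_cons, zeroState_cons]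
  simp [hadamardGate]

theorem smul_zeroState (a : ℂ) :
    (fun y : Bits q => a * zeroState q y) = a • zeroState q := rfl

variable {n : ℕ} {v c : EuclideanSpace ℂ (Fin n)} {Uv Uc}

/-- Up to `1/√2` the state evolves as `|0⟩|0⟩ + |1⟩|0⟩`, `|0⟩|0⟩ + |1⟩|c⟩`, `|1⟩|0⟩ + u|0⟩|c⟩`,
`|1⟩|v⟩ + u|0⟩|c⟩`. -/
theorem testState_true (hv : Prepares Uv v) (z : Bits q) :
    testState Uv Uc u hu (Fin.cons true z) = ((√2 : ℝ) : ℂ)⁻¹ * encode q v z := by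
  rw [testState, prepMatrix, ← mulVec_mulVec, controlled_mulVec_true, ← mulVec_mulVec]
  simp only [oneQubit_mulVec_cons, ← mulVec_mulVec, controlled_mulVec_true,
    controlled_mulVec_false, hadamard_zeroState, phaseSwapGate, of_apply, if_true, zero_mul,
    zero_add, reduceCtorEq, if_false, one_mul, smul_zeroState, mulVec_smul, Pi.smul_apply,
    smul_eq_mul]
  rw [show Uv.1 *ᵥ zeroState q = _ from hv]

theorem testState_false (hc : Prepares Uc c) (z : Bits q) :
    testState Uv Uc u hu (Fin.cons false z) = ((√2 : ℝ) : ℂ)⁻¹ * (u * encode q c z) := by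
  rw [testState, prepMatrix, ← mulVec_mulVec, controlled_mulVec_false, ← mulVec_mulVec]
  simp only [oneQubit_mulVec_cons, ← mulVec_mulVec, controlled_mulVec_true,
    controlled_mulVec_false, hadamard_zeroState, phaseSwapGate, of_apply, if_true, zero_mul,
    add_zero, if_false, smul_zeroState, mulVec_smul, Pi.smul_apply,
    smul_eq_mul, Bool.false_eq_true]
  rw [show Uc.1 *ᵥ zeroState q = _ from hc]
  ring

/-- Indices below `2 ^ q` have distinct binary labels, so the encoding is isometric. -/
theorem encode_dotProduct (hn : n ≤ 2 ^ q) (v c : EuclideanSpace ℂ (Fin n)) :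
    star (encode q v) ⬝ᵥ encode q c = inner ℂ v c := by
  have hinj : Injective fun (i : Fin n) (k : Fin q) => Nat.testBit i k := by
    intro i j h
    refine Fin.ext (Nat.eq_of_testBit_eq fun k => ?_)
    by_cases hk : k < q
    · exact congrFun h ⟨k, hk⟩
    · have hq : 2 ^ q ≤ 2 ^ k := Nat.pow_le_pow_right (by norm_num) (by omega)
      rw [Nat.testBit_lt_two_pow (by omega), Nat.testBit_lt_two_pow (by omega)]
  rw [EuclideanSpace.inner_eq_star_dotProduct, dotProduct_comm]
  symm
  apply Fintype.sum_of_injective _ hinj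
  · intro b hb
    have : encode q c b = 0 :=
      Finset.sum_eq_zero fun i _ => if_neg fun h => hb ⟨i, h⟩
    rw [this, zero_mul]
  · intro i
    have (w : EuclideanSpace ℂ (Fin n)) : encode q w (fun k => Nat.testBit i k) = w i := by
      rw [encode, Finset.sum_eq_single i]
      · simp
      · intro j _ hj
        exact if_neg fun h => hj (hinj h)
      · simp
    simp only [Pi.star_apply, this]

/-- The matrix of the Pauli `X` gate on the control qubit. -/
def flipMatrix (q : ℕ) : Matrix (Bits (q + 1)) (Bits (q + 1)) ℂ :=
  onWires (wire 0) (oneQubit notGate.1)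

theorem flipMatrix_mulVec_cons (ψ : Bits (q + 1) → ℂ) (b : Bool) (z : Bits q) :
    (flipMatrix q *ᵥ ψ) (Fin.cons b z) = ψ (Fin.cons (!b) z) := by
  rw [flipMatrix, oneQubit_mulVec_cons]
  cases b <;> simp [notGate, symmetricGate]

theorem flipMatrix_mulVec_mulVec (ψ : Bits (q + 1) → ℂ) :
    flipMatrix q *ᵥ (flipMatrix q *ᵥ ψ) = ψ := by
  funext x
  induction x using bits_cases <;> simp [flipMatrix_mulVec_cons]

theorem flipMatrix_conjTranspose : (flipMatrix q)ᴴ = flipMatrix q := by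
  rw [flipMatrix, onWires_conjTranspose, oneQubit_conjTranspose]
  congr 2
  ext x y
  cases x <;> cases y <;> simp [notGate, symmetricGate]

/-- The flip exchanges the two branches, leaving half the sum of `u * ⟪v, c⟫` and its conjugate. -/
theorem testState_flip (hn : n ≤ 2 ^ q) (hv : Prepares Uv v) (hc : Prepares Uc c) :
    star (testState Uv Uc u hu) ⬝ᵥ (flipMatrix q *ᵥ testState Uv Uc u hu) =
      ((u * inner ℂ v c).re : ℂ) := by
  have h1 := encode_dotProduct hn v c
  have h2 := encode_dotProduct hn c v
  rw [dotProduct] at h1 h2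
  rw [dotProduct, sum_bits_succ]
  simp only [flipMatrix_mulVec_cons, Pi.star_apply, testState_true u hu hv,
    testState_false u hu hc, Bool.not_true, Bool.not_false]
  have hr : star (((√2 : ℝ) : ℂ)⁻¹) = ((√2 : ℝ) : ℂ)⁻¹ := by
    rw [star_inv₀]
    exact congrArg _ (Complex.conj_ofReal _)
  have e1 (z : Bits q) : star (((√2 : ℝ) : ℂ)⁻¹ * encode q v z) *
      (((√2 : ℝ) : ℂ)⁻¹ * (u * encode q c z)) =
      1 / 2 * u * (star (encode q v z) * encode q c z) := by
    rw [star_mul', hr]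
    linear_combination (star (encode q v z) * (u * encode q c z)) * inv_sqrt_two_mul_self
  have e2 (z : Bits q) : star (((√2 : ℝ) : ℂ)⁻¹ * (u * encode q c z)) *
      (((√2 : ℝ) : ℂ)⁻¹ * encode q v z) =
      1 / 2 * star u * (star (encode q c z) * encode q v z) := by
    rw [star_mul', star_mul', hr]
    linear_combination
      (star u * star (encode q c z) * encode q v z) * inv_sqrt_two_mul_self
  simp only [Pi.star_apply] at h1 h2
  simp only [e1, e2]
  rw [← Finset.mul_sum, ← Finset.mul_sum, h1, h2, Complex.re_eq_add_conj, map_mul, inner_conj_symm]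
  simp only [Complex.star_def]
  ring

/-! ### The estimation circuit -/

/-- The circuit preparing the test state. -/
def prepCircuit (q : ℕ) (u : ℂ) (hu : ‖u‖ = 1) : Circuit q (width q) :=
  [oneGate hadamardGate (sysWire 0), .ctrlOracle .c false (Fin.castAddEmb (q + 2)),
    oneGate (phaseSwapGate u hu) (sysWire 0), .ctrlOracle .v false (Fin.castAddEmb (q + 2))]

/-- The inverse of `prepCircuit`. -/
def prepInvCircuit (q : ℕ) (u : ℂ) (hu : ‖u‖ = 1) : Circuit q (width q) :=
  [.ctrlOracle .v true (Fin.castAddEmb (q + 2)), oneGate (star (phaseSwapGate u hu)) (sysWire 0),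
    .ctrlOracle .c true (Fin.castAddEmb (q + 2)), oneGate (star hadamardGate) (sysWire 0)]

variable (Uv Uc)

theorem oneGate_pad (M : unitaryGroup Bool ℂ) (ψ : Bits (q + 1) → ℂ) :
    (oneGate M (sysWire 0) : Gate q (width q)).matrix Uv Uc *ᵥ pad (q + 2) ψ =
      pad (q + 2) (onWires (wire 0) (oneQubit M.1) *ᵥ ψ) :=
  onWires_pad (q + 2) (wire 0) (oneQubit M.1) ψ

theorem ctrlOracle_pad (o : OracleName) (inv : Bool) (ψ : Bits (q + 1) → ℂ) :
    (.ctrlOracle o inv (Fin.castAddEmb (q + 2)) : Gate q (width q)).matrix Uv Uc *ᵥ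
      pad (q + 2) ψ = pad (q + 2) (controlled (oracleMatrix Uv Uc o inv) *ᵥ ψ) := by
  have := onWires_pad (q + 2) (Function.Embedding.refl _) (controlled (oracleMatrix Uv Uc o inv)) ψ
  rw [onWires_refl] at this
  exact this

theorem prepCircuit_run (ψ : Bits (q + 1) → ℂ) :
    Circuit.run Uv Uc (prepCircuit q u hu) (pad (q + 2) ψ) =
      pad (q + 2) (prepMatrix Uv Uc u hu *ᵥ ψ) := by
  simp only [prepCircuit, Circuit.run_cons, Circuit.run_nil, oneGate_pad, ctrlOracle_pad,
    prepMatrix, ← mulVec_mulVec]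
  rfl

theorem prepInvCircuit_run (ψ : Bits (q + 1) → ℂ) :
    Circuit.run Uv Uc (prepInvCircuit q u hu) (pad (q + 2) ψ) =
      pad (q + 2) ((prepMatrix Uv Uc u hu)ᴴ *ᵥ ψ) := by
  simp only [prepInvCircuit, Circuit.run_cons, Circuit.run_nil, oneGate_pad, ctrlOracle_pad,
    prepMatrix, ← mulVec_mulVec, conjTranspose_mul, controlled_conjTranspose,
    onWires_conjTranspose, oneQubit_conjTranspose]
  rfl

/-- One step of the walk. -/
def walkCircuit (q : ℕ) (u : ℂ) (hu : ‖u‖ = 1) : Circuit q (width q) :=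
  oneGate notGate (sysWire 0) :: (prepInvCircuit q u hu ++ (reflectZero q ++ prepCircuit q u hu))

/-- Conjugating the reflection about `|0⟩` by the preparation unitary gives the reflection about the
test state. -/
theorem walkCircuit_run (ψ : Bits (q + 1) → ℂ) :
    Circuit.run Uv Uc (walkCircuit q u hu) (pad (q + 2) ψ) =
      pad (q + 2) ((2 * (star (testState Uv Uc u hu) ⬝ᵥ (flipMatrix q *ᵥ ψ))) •
        testState Uv Uc u hu - flipMatrix q *ᵥ ψ) := by
  rw [walkCircuit, Circuit.run_cons, oneGate_pad, Circuit.run_append, prepInvCircuit_run,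
    Circuit.run_append, reflectZero_run_eq, prepCircuit_run, mulVec_sub, mulVec_smul,
    mulVec_mulVec _ (prepMatrix Uv Uc u hu), prepMatrix_mul_conjTranspose, one_mulVec,
    dotProduct_mulVec, ← star_mulVec]
  rfl

/-- `j` steps of the walk. -/
def walkCircuits (q : ℕ) (u : ℂ) (hu : ‖u‖ = 1) : ℕ → Circuit q (width q)
  | 0 => []
  | j + 1 => walkCircuits q u hu j ++ walkCircuit q u hu

/-- `j` steps of the walk from the test state, and a Hadamard gate on the control qubit. -/
def testCircuit (q : ℕ) (u : ℂ) (hu : ‖u‖ = 1) (j : ℕ) : Circuit q (width q) :=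
  prepCircuit q u hu ++ (walkCircuits q u hu j ++ [oneGate hadamardGate (sysWire 0)])

theorem walkCircuits_run (j : ℕ) :
    Circuit.run Uv Uc (walkCircuits q u hu j) (pad (q + 2) (testState Uv Uc u hu)) =
      pad (q + 2) (walk (flipMatrix q) (testState Uv Uc u hu) j) := by
  induction j with
  | zero => rfl
  | succ j ih => rw [walkCircuits, Circuit.run_append, ih, walkCircuit_run]; rfl

theorem testCircuit_state (j : ℕ) :
    (testCircuit q u hu j).state Uv Uc = pad (q + 2) (onWires (wire 0) (oneQubit hadamardGate.1) *ᵥ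
      walk (flipMatrix q) (testState Uv Uc u hu) j) := by
  rw [Circuit.state_eq_run, testCircuit, Circuit.run_append, ← pad_zeroState, prepCircuit_run,
    Circuit.run_append]
  change Circuit.run Uv Uc _ (Circuit.run Uv Uc _ (pad (q + 2) (testState Uv Uc u hu))) = _
  rw [walkCircuits_run, Circuit.run_cons, oneGate_pad, Circuit.run_nil]

theorem star_dotProduct_self_eq {ι : Type*} [Fintype ι] (ψ : ι → ℂ) :
    star ψ ⬝ᵥ ψ = ((∑ i, ‖ψ i‖ ^ 2 : ℝ) : ℂ) := by
  simp [dotProduct, Complex.conj_mul']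

theorem state_norm {m : ℕ} (K : Circuit q m) : ∑ x, ‖K.state Uv Uc x‖ ^ 2 = 1 := by
  suffices H : ∀ ψ : Bits m → ℂ, star (Circuit.run Uv Uc K ψ) ⬝ᵥ Circuit.run Uv Uc K ψ =
      star ψ ⬝ᵥ ψ by
    have := H (zeroState m)
    rw [star_zeroState_dotProduct_self, star_dotProduct_self_eq] at this
    exact_mod_cast this
  induction K with
  | nil => exact fun ψ => rfl
  | cons g K ih =>
    intro ψ
    have hg := mem_unitaryGroup_iff'.1 (g.matrix_mem_unitaryGroup Uv Uc)
    rw [star_eq_conjTranspose] at hg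
    rw [Circuit.run_cons, ih, star_mulVec, ← dotProduct_mulVec, mulVec_mulVec, hg, one_mulVec]

variable {Uv Uc}

/-- The probability of measuring `0` on the control qubit after `testCircuit`. -/
theorem testCircuit_prob_false (hn : n ≤ 2 ^ q) (hv : Prepares Uv v) (hc : Prepares Uc c)
    (φ : ℝ) (hφ : (u * inner ℂ v c).re = Real.cos φ) (j : ℕ) :
    ∑ x, (if x (sysWire 0) = false then ‖(testCircuit q u hu j).state Uv Uc x‖ ^ 2 else 0) =
      (1 + Real.cos ((2 * j + 1) * φ)) / 2 := by
  rw [testCircuit_state]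
  refine (sum_norm_sq_pad (fun y => y 0 = false) _).trans ?_
  set ψ := walk (flipMatrix q) (testState Uv Uc u hu) j with hψ
  have h := walk_norm (flipMatrix q) flipMatrix_mulVec_mulVec flipMatrix_conjTranspose
    (testState Uv Uc u hu) (testState_norm Uv Uc u hu) φ
    (by rw [testState_flip u hu hn hv hc, hφ]) j
  rw [star_dotProduct_self_eq, ← hψ, sum_bits_succ] at h
  have h' := Complex.ofReal_injective h
  simp only [Pi.add_apply, flipMatrix_mulVec_cons, Bool.not_true, Bool.not_false] at h'
  rw [sum_bits_succ]
  simp only [Fin.cons_zero, reduceCtorEq, if_false, if_true, Finset.sum_const_zero, zero_add,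
    oneQubit_mulVec_cons]
  -- The Hadamard gate makes the probability of `0` a quarter of `‖ψ + X ψ‖²`, to which both control
  -- branches contribute equally.
  have e (z : Bits q) : ‖hadamardGate.1 false true * ψ (Fin.cons true z) +
      hadamardGate.1 false false * ψ (Fin.cons false z)‖ ^ 2 =
      1 / 2 * ‖ψ (Fin.cons true z) + ψ (Fin.cons false z)‖ ^ 2 := by
    have : hadamardGate.1 false true * ψ (Fin.cons true z) +
        hadamardGate.1 false false * ψ (Fin.cons false z) =
        ((√2 : ℝ) : ℂ)⁻¹ * (ψ (Fin.cons true z) + ψ (Fin.cons false z)) := by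
      simp [hadamardGate]
      ring
    rw [this, norm_mul, mul_pow, norm_inv, Complex.norm_real, Real.norm_eq_abs, inv_pow, sq_abs,
      Real.sq_sqrt (by norm_num)]
    norm_num
  simp only [e, ← Finset.mul_sum]
  have hsymm : ∑ z : Bits q, ‖ψ (Fin.cons false z) + ψ (Fin.cons true z)‖ ^ 2 =
      ∑ z : Bits q, ‖ψ (Fin.cons true z) + ψ (Fin.cons false z)‖ ^ 2 := by
    simp only [add_comm]
  rw [hsymm] at h'
  linarith

end

end QAlg

end

noncomputable section

namespace QAlg

open Matrix Function

/-! ### Running times -/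

section

variable {q m : ℕ} (T₁ Tv Tc : ℝ≥0)

theorem Circuit.time_nil : Circuit.time T₁ Tv Tc ([] : Circuit q m) = 0 := rfl

theorem Circuit.time_cons (g : Gate q m) (K : Circuit q m) :
    Circuit.time T₁ Tv Tc (g :: K) = g.time T₁ Tv Tc + Circuit.time T₁ Tv Tc K := by
  simp [Circuit.time]

theorem Circuit.time_append (K L : Circuit q m) :
    Circuit.time T₁ Tv Tc (K ++ L) = Circuit.time T₁ Tv Tc K + Circuit.time T₁ Tv Tc L := by
  simp [Circuit.time]

theorem oneGate_time (M : unitaryGroup Bool ℂ) (t : Fin m) :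
    (oneGate M t : Gate q m).time T₁ Tv Tc = T₁ := rfl

theorem ladderStep_time (i : Fin (q + 1)) :
    Circuit.time T₁ Tv Tc (ladderStep i) = 7 * T₁ := by
  simp only [ladderStep, toffoli, Circuit.time_cons, Circuit.time_append, Circuit.time_nil,
    oneGate, ctrlGate, Gate.time]
  ring

theorem reflectZero_time : Circuit.time T₁ Tv Tc (reflectZero q) = (14 * q + 17) * T₁ := by
  have h (L : List (Fin (q + 1))) (D : Circuit q (width q)) :
      Circuit.time T₁ Tv Tc (L.foldr (fun i K => ladderStep i ++ K ++ ladderStep i) D) =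
        L.length * (14 * T₁) + Circuit.time T₁ Tv Tc D := by
    induction L with
    | nil => simp
    | cons i L ih =>
      rw [List.foldr_cons, Circuit.time_append, Circuit.time_append, ih, ladderStep_time,
        List.length_cons]
      push_cast
      ring
  rw [reflectZero, Circuit.time_cons, Circuit.time_append, h, List.length_finRange]
  simp only [Circuit.time_cons, Circuit.time_nil, oneGate_time]
  push_cast
  ring

theorem prepCircuit_time (u : ℂ) (hu : ‖u‖ = 1) :
    Circuit.time T₁ Tv Tc (prepCircuit q u hu) = 2 * T₁ + Tv + Tc := by
  simp only [prepCircuit, Circuit.time_cons, Circuit.time_nil, oneGate, Gate.time]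
  ring

theorem prepInvCircuit_time (u : ℂ) (hu : ‖u‖ = 1) :
    Circuit.time T₁ Tv Tc (prepInvCircuit q u hu) = 2 * T₁ + Tv + Tc := by
  simp only [prepInvCircuit, Circuit.time_cons, Circuit.time_nil, oneGate, Gate.time]
  ring

theorem walkCircuits_time (u : ℂ) (hu : ‖u‖ = 1) (j : ℕ) :
    Circuit.time T₁ Tv Tc (walkCircuits q u hu j) =
      j * (2 * (Tv + Tc) + (14 * q + 22) * T₁) := by
  induction j with
  | zero => simp [walkCircuits, Circuit.time_nil]
  | succ j ih =>
    rw [walkCircuits, Circuit.time_append, ih, walkCircuit, Circuit.time_cons, Circuit.time_append,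
      Circuit.time_append, prepInvCircuit_time, prepCircuit_time, reflectZero_time, oneGate_time]
    push_cast
    ring

/-- The preparation uses each unitary once and a walk step uses each twice, hence the factor `2j+1`;
the `q` comes from the ladder. -/
theorem testCircuit_time_le (u : ℂ) (hu : ‖u‖ = 1) (j : ℕ) :
    (Circuit.time T₁ Tv Tc (testCircuit q u hu j) : ℝ) ≤
      (2 * j + 1) * (Tv + Tc + 11 * (q + 1) * T₁) := by
  rw [testCircuit, Circuit.time_append, Circuit.time_append, prepCircuit_time, walkCircuits_time,
    Circuit.time_cons, Circuit.time_nil, oneGate_time]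
  push_cast
  have h1 : 0 ≤ (q : ℝ) * T₁ := by positivity
  have h2 : 0 ≤ (j : ℝ) * (q * T₁) := by positivity
  have h3 : 0 ≤ (T₁ : ℝ) := T₁.2
  nlinarith

/-! ### Repeated measurements -/

/-- Runs the circuit `K` for a given number of times, adds to a counter the number of outcomes
with the given flag, and continues depending on the value of the counter. -/
def repeatTest (K : Circuit q m) (flag : Bits m → Bool) (next : ℕ → Algorithm q) :
    ℕ → ℕ → Algorithm q
  | 0, c => next c
  | r + 1, c => .measure m K fun x => repeatTest K flag next r (if flag x = true then c + 1 else c)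

theorem repeatTest_time_le (K : Circuit q m) (flag : Bits m → Bool) (next : ℕ → Algorithm q)
    (T : ℝ≥0) (hT : ∀ c, (next c).time T₁ Tv Tc ≤ T) (r c : ℕ) :
    (repeatTest K flag next r c).time T₁ Tv Tc ≤ r * K.time T₁ Tv Tc + T := by
  induction r generalizing c with
  | zero => simpa [repeatTest] using hT c
  | succ r ih =>
    rw [repeatTest, Algorithm.time]
    calc _ ≤ K.time T₁ Tv Tc + (r * K.time T₁ Tv Tc + T) :=
          add_le_add le_rfl (Finset.sup_le fun x _ => ih _)
      _ = _ := by push_cast; ring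

variable (Uv Uc : unitaryGroup (Bits q) ℂ)

theorem Algorithm.prob_nonneg (S : Set ℝ) (A : Algorithm q) : 0 ≤ A.prob Uv Uc S := by
  induction A with
  | output d => exact Set.indicator_nonneg (fun _ _ => zero_le_one) _
  | measure m K next ih =>
    exact Finset.sum_nonneg fun x _ => mul_nonneg (sq_nonneg _) (ih x)

/-- The probability that the outcome of measuring the final state of `K` has the given flag. -/
def flagProb (K : Circuit q m) (flag : Bits m → Bool) : ℝ :=
  ∑ x, if flag x = true then ‖K.state Uv Uc x‖ ^ 2 else 0

theorem flagProb_nonneg (K : Circuit q m) (flag : Bits m → Bool) : 0 ≤ flagProb Uv Uc K flag :=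
  Finset.sum_nonneg fun x _ => by split_ifs <;> positivity

theorem flagProb_add_not (K : Circuit q m) (flag : Bits m → Bool) :
    flagProb Uv Uc K flag + flagProb Uv Uc K (fun x => !flag x) = 1 := by
  rw [← state_norm Uv Uc K, flagProb, flagProb, ← Finset.sum_add_distrib]
  refine Finset.sum_congr rfl fun x _ => ?_
  cases flag x <;> simp

/-- Markov's inequality: `z ρ^c (1 + p(ρ-1))^r` is the expectation of `z ρ^k` over the final count
`k`, and it dominates the probability of the counts where `next` has no guarantee. -/
theorem repeatTest_prob (K : Circuit q m) (flag : Bits m → Bool) (next : ℕ → Algorithm q)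
    (S : Set ℝ) {η z ρ : ℝ} (hη : 0 ≤ η) (hz : 0 ≤ z) (hρ : 0 ≤ ρ)
    (h : ∀ k, 1 - η ≤ (next k).prob Uv Uc S ∨ 1 ≤ z * ρ ^ k) (r c : ℕ) :
    1 - η - z * ρ ^ c * (1 + flagProb Uv Uc K flag * (ρ - 1)) ^ r ≤
      (repeatTest K flag next r c).prob Uv Uc S := by
  induction r generalizing c with
  | zero =>
    rw [repeatTest, pow_zero, mul_one]
    rcases h c with h | h
    · have : 0 ≤ z * ρ ^ c := by positivity
      linarith
    · have := Algorithm.prob_nonneg Uv Uc S (next c)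
      linarith
  | succ r ih =>
    rw [repeatTest, Algorithm.prob]
    set p := flagProb Uv Uc K flag with hp
    have hp' : flagProb Uv Uc K (fun x => !flag x) = 1 - p := by
      linarith [flagProb_add_not Uv Uc K flag]
    set B : ℕ → ℝ := fun c => 1 - η - z * ρ ^ c * (1 + p * (ρ - 1)) ^ r with hB
    have key : ∑ x, ‖K.state Uv Uc x‖ ^ 2 * B (if flag x = true then c + 1 else c) =
        p * B (c + 1) + (1 - p) * B c := by
      rw [← hp', hp, flagProb, flagProb, Finset.sum_mul, Finset.sum_mul, ← Finset.sum_add_distrib]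
      refine Finset.sum_congr rfl fun x _ => ?_
      cases flag x <;> simp
    calc 1 - η - z * ρ ^ c * (1 + p * (ρ - 1)) ^ (r + 1)
        = p * B (c + 1) + (1 - p) * B c := by simp only [hB]; ring
      _ = _ := key.symm
      _ ≤ _ := Finset.sum_le_sum fun x _ => mul_le_mul_of_nonneg_left (ih _) (sq_nonneg _)

/-- A Chernoff bound for `repeatTest`, with exponent `l` of either sign. -/
theorem repeatTest_chernoff (K : Circuit q m) (flag : Bits m → Bool) (next : ℕ → Algorithm q)
    (S : Set ℝ) {η l t : ℝ} (hη : 0 ≤ η) (hl : |l| ≤ 1) (r : ℕ)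
    (h : ∀ k : ℕ, 1 - η ≤ (next k).prob Uv Uc S ∨ 0 ≤ l * (k - t * r)) :
    1 - η - Real.exp (r * (l ^ 2 - l * (t - flagProb Uv Uc K flag))) ≤
      (repeatTest K flag next r 0).prob Uv Uc S := by
  set p := flagProb Uv Uc K flag with hp
  have hp0 : 0 ≤ p := flagProb_nonneg Uv Uc K flag
  have hp1 : p ≤ 1 := by
    linarith [flagProb_add_not Uv Uc K flag, flagProb_nonneg Uv Uc K fun x => !flag x]
  -- The weight is `exp (l (k - t r))`, at least `1` on the bad side of the threshold `t r`; the
  -- sign of `l` selects the tail.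
  have h1 := repeatTest_prob Uv Uc K flag next S (η := η) (z := Real.exp (-(l * (t * r))))
    (ρ := Real.exp l) hη (Real.exp_nonneg _) (Real.exp_nonneg _) (fun k => (h k).imp_right
      fun hk => by
        rw [← Real.exp_nat_mul, ← Real.exp_add]
        exact Real.one_le_exp (by linarith)) r 0
  refine le_trans (sub_le_sub_left ?_ _) h1
  rw [pow_zero, mul_one, ← hp]
  have h2 : Real.exp l - 1 ≤ l + l ^ 2 := by
    linarith [le_abs_self (Real.exp l - 1 - l), Real.abs_exp_sub_one_sub_id_le hl]
  have h3 : 1 + p * (Real.exp l - 1) ≤ Real.exp (l * p + l ^ 2) := by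
    have : p * (Real.exp l - 1) ≤ p * (l + l ^ 2) := mul_le_mul_of_nonneg_left h2 hp0
    have : p * l ^ 2 ≤ 1 * l ^ 2 := mul_le_mul_of_nonneg_right hp1 (sq_nonneg _)
    linarith [Real.add_one_le_exp (l * p + l ^ 2)]
  have h4 : 0 ≤ 1 + p * (Real.exp l - 1) := by
    have := mul_nonneg hp0 (Real.exp_nonneg l)
    linarith
  calc _ ≤ Real.exp (-(l * (t * r))) * Real.exp (l * p + l ^ 2) ^ r :=
        mul_le_mul_of_nonneg_left (pow_le_pow_left₀ h4 h3 r) (Real.exp_nonneg _)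
    _ = _ := by
        rw [← Real.exp_nat_mul, ← Real.exp_add]
        congr 1
        ring

end

end QAlg

end

namespace QAlg

open Real

/-! ### Choosing the number of steps of the walk -/

/-- There is an odd number between `x / 3` and `x`. -/
theorem exists_odd_le {x : ℝ} (hx : 1 ≤ x) : ∃ j : ℕ, (2 * j + 1 : ℝ) ≤ x ∧ x ≤ 3 * (2 * j + 1) := by
  have h0 : 0 ≤ (x - 1) / 2 := by linarith
  refine ⟨⌊(x - 1) / 2⌋₊, ?_, ?_⟩
  · linarith [Nat.floor_le h0]
  · have := Nat.lt_floor_add_one ((x - 1) / 2)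
    have h1 : (0 : ℝ) ≤ ⌊(x - 1) / 2⌋₊ := Nat.cast_nonneg _
    linarith

theorem half_le_sin {x : ℝ} (h1 : π / 6 ≤ x) (h2 : x ≤ 5 * π / 6) : 1 / 2 ≤ sin x := by
  rw [← cos_pi_div_two_sub, ← cos_abs, ← cos_pi_div_three]
  apply cos_le_cos_of_nonneg_of_le_pi (abs_nonneg _) (by linarith [pi_pos])
  rw [abs_le]
  constructor <;> linarith

theorem abs_cos_nat_mul_pi (n : ℕ) : |cos (n * π)| = 1 := by
  rw [cos_nat_mul_pi, abs_neg_one_pow]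

/-- If `|sin a|` is small, then a shift by `b` with `|sin b|` large makes it larger. -/
theorem le_abs_sin_add {a b : ℝ} (ha : |sin a| < 1 / 5) (hb : 1 / 2 ≤ |sin b|) :
    1 / 5 ≤ |sin (a + b)| := by
  have h1 : (9 / 10 : ℝ) ≤ |cos a| := by
    apply le_of_sq_le_sq _ (abs_nonneg _)
    rw [sq_abs, cos_sq']
    have : sin a ^ 2 ≤ (1 / 5) ^ 2 := by
      rw [← sq_abs]
      exact pow_le_pow_left₀ (abs_nonneg _) ha.le 2
    linarith
  have h2 : |cos a * sin b| ≤ |sin (a + b)| + |sin a * cos b| := by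
    rw [show cos a * sin b = sin (a + b) - sin a * cos b by rw [sin_add]; ring]
    exact abs_sub _ _
  rw [abs_mul, abs_mul] at h2
  have h3 : |sin a| * |cos b| ≤ 1 / 5 * 1 :=
    mul_le_mul ha.le (abs_cos_le_one b) (abs_nonneg _) (by norm_num)
  have h4 : (9 / 10 : ℝ) * (1 / 2) ≤ |cos a| * |sin b| :=
    mul_le_mul h1 hb (by norm_num) (abs_nonneg _)
  linarith

/-- A multiple of a small angle lies in `[π / 6, 5 π / 6]`. -/
theorem exists_mul_sin {x : ℝ} (h0 : 0 < x) (h1 : x ≤ π / 2) :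
    ∃ m : ℕ, 1 / 2 ≤ sin (m * x) ∧ m * x ≤ π / 6 + x := by
  have h2 := Nat.le_ceil (π / 6 / x)
  have h3 := Nat.ceil_lt_add_one (div_pos (div_pos pi_pos (by norm_num : (0 : ℝ) < 6)) h0).le
  have h4 : π / 6 ≤ ⌈π / 6 / x⌉₊ * x := (div_le_iff₀ h0).1 h2
  have h5 : ⌈π / 6 / x⌉₊ * x ≤ π / 6 + x := by
    have := mul_le_mul_of_nonneg_right h3.le h0.le
    rwa [add_mul, div_mul_cancel₀ _ h0.ne', one_mul] at this
  exact ⟨_, half_le_sin h4 (by linarith), h5⟩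

/-- If `μ` is much larger than `h`, then some odd multiple `k μ` with `k` about `1 / h` is away from
the multiples of `π`. -/
theorem exists_odd_abs_sin {μ h : ℝ} (h0 : 0 < h) (hμ : 100 * h ≤ μ) (hμ' : μ ≤ π / 2) :
    ∃ j : ℕ, 1 / 50 ≤ (2 * j + 1) * h ∧ (2 * j + 1) * h ≤ 1 / 5 ∧
      1 / 5 ≤ |sin ((2 * j + 1) * μ)| := by
  have hpi := pi_lt_d2
  have hpi' := pi_gt_three
  -- Taking `k h` in `[1/50, 3/50]` leaves `7/50` for the correction below without exceeding `1/5`.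
  obtain ⟨j, hj1, hj2⟩ := exists_odd_le (x := 3 / 50 / h) (by
    rw [le_div_iff₀ h0]; linarith)
  rw [le_div_iff₀ h0] at hj1
  have hj3 : 1 / 50 ≤ (2 * j + 1) * h := by
    rw [div_le_iff₀ h0] at hj2
    linarith
  by_cases hs : 1 / 5 ≤ |sin ((2 * j + 1) * μ)|
  · exact ⟨j, hj3, by linarith, hs⟩
  push Not at hs
  -- If `k μ` is close to a multiple of `π`, `k` is replaced by `k + 2m`: the parity is kept and
  -- `le_abs_sin_add` applies.
  suffices H : ∃ m : ℕ, 1 / 2 ≤ |sin (2 * m * μ)| ∧ 2 * m * h ≤ 7 / 50 by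
    obtain ⟨m, hm1, hm2⟩ := H
    refine ⟨j + m, ?_, ?_, ?_⟩
    · push_cast
      have : 0 ≤ (m : ℝ) * h := by positivity
      linarith
    · push_cast
      linarith
    · have := le_abs_sin_add hs hm1
      rw [← add_mul] at this
      push_cast
      rwa [show (2 * ((j : ℝ) + m) + 1) = 2 * j + 1 + 2 * m by ring]
  rcases le_total μ (π / 4) with h4 | h4
  · obtain ⟨m, hm1, hm2⟩ := exists_mul_sin (x := 2 * μ) (by linarith) (by linarith)
    refine ⟨m, ?_, ?_⟩
    · rw [show 2 * (m : ℝ) * μ = m * (2 * μ) by ring]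
      exact hm1.trans (le_abs_self _)
    · have : (m : ℝ) * (100 * h) ≤ m * μ := mul_le_mul_of_nonneg_left hμ (Nat.cast_nonneg _)
      linarith
  -- Here `2μ = π - 2ν`, so steps of `2` turn by `2ν` up to sign. As `k` is odd, `|sin (kμ)| = |cos
  -- (kν)|`; its smallness forces `kν > 1`, so an `m` of order `k` suffices.
  · set ν := π / 2 - μ with hν
    have hsin : |sin ((2 * j + 1) * μ)| = |cos ((2 * j + 1) * ν)| := by
      rw [show (2 * (j : ℝ) + 1) * μ = j * π + (π / 2 - (2 * j + 1) * ν) by rw [hν]; ring,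
        sin_add, sin_nat_mul_pi, zero_mul, zero_add, abs_mul, abs_cos_nat_mul_pi, one_mul,
        sin_pi_div_two_sub]
    have hν0 : 0 ≤ ν := by linarith
    have hk : 1 < (2 * j + 1) * ν := by
      by_contra! hle
      have h1 : cos 1 ≤ cos ((2 * j + 1) * ν) :=
        cos_le_cos_of_nonneg_of_le_pi (by positivity) (by linarith) hle
      have h2 := cos_one_pos
      have h3 : 1 - 1 ^ 2 / 2 ≤ cos 1 := one_sub_sq_div_two_le_cos
      have h4 := le_abs_self (cos ((2 * j + 1) * ν))
      linarith
    have hνpos : 0 < ν := by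
      rcases hν0.eq_or_lt with h | h
      · rw [← h] at hk
        norm_num at hk
      · exact h
    obtain ⟨m, hm1, hm2⟩ := exists_mul_sin (x := 2 * ν) (by linarith) (by linarith)
    refine ⟨m, ?_, ?_⟩
    · rw [show 2 * (m : ℝ) * μ = m * π - m * (2 * ν) by rw [hν]; ring, sin_sub, sin_nat_mul_pi,
        zero_mul, zero_sub, abs_neg, abs_mul, abs_cos_nat_mul_pi, one_mul]
      exact hm1.trans (le_abs_self _)
    · have hA : ((m : ℝ) - 1) * (2 * ν) ≤ π / 6 := by linarith
      have hB : ((m : ℝ) - 1) * 2 ≤ π / 6 * (2 * j + 1) := by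
        by_contra! hlt
        have h1 : π / 6 * (2 * j + 1) * ν < ((m : ℝ) - 1) * 2 * ν :=
          mul_lt_mul_of_pos_right hlt hνpos
        have h2 : π / 6 * 1 ≤ π / 6 * ((2 * j + 1) * ν) :=
          mul_le_mul_of_nonneg_left hk.le (by linarith)
        linarith
      have hC : ((m : ℝ) - 1) * 2 * h ≤ π / 6 * (2 * j + 1) * h :=
        mul_le_mul_of_nonneg_right hB h0.le
      have hD : π / 6 * ((2 * j + 1) * h) ≤ π / 6 * (3 / 50) :=
        mul_le_mul_of_nonneg_left hj1 (by linarith)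
      linarith

theorem exists_odd_sin_of_le {μ h : ℝ} (h0 : 0 < h) (hμ : h ≤ μ) (hμ' : μ ≤ π / 2) :
    ∃ (j : ℕ) (s : ℝ), (s = 1 ∨ s = -1) ∧ 1 / 200 ≤ (2 * j + 1) * h ∧ (2 * j + 1) * h ≤ 2 ∧
      ∀ y, |y - μ| ≤ h / 2 → 1 / 10 ≤ s * sin ((2 * j + 1) * y) := by
  have hpi := pi_lt_d2
  have hpi' := pi_gt_three
  have hμ0 : 0 < μ := h0.trans_le hμ
  rcases le_total (100 * h) μ with hl | hl
  · obtain ⟨j, h1, h2, h3⟩ := exists_odd_abs_sin h0 hl hμ'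
    have hy (y : ℝ) (hy : |y - μ| ≤ h / 2) :
        |sin ((2 * j + 1) * y) - sin ((2 * j + 1) * μ)| ≤ 1 / 10 := by
      refine (abs_sin_sub_sin_le _ _).trans ?_
      rw [← mul_sub, abs_mul, abs_of_pos (by positivity)]
      have : (2 * (j : ℝ) + 1) * |y - μ| ≤ (2 * j + 1) * (h / 2) :=
        mul_le_mul_of_nonneg_left hy (by positivity)
      linarith
    rcases le_abs.1 h3 with h3 | h3
    · refine ⟨j, 1, Or.inl rfl, by linarith, by linarith, fun y hy' => ?_⟩
      have := (abs_le.1 (hy y hy')).1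
      linarith
    · refine ⟨j, -1, Or.inr rfl, by linarith, by linarith, fun y hy' => ?_⟩
      have := (abs_le.1 (hy y hy')).2
      linarith
  -- Near the endpoint `0`, `k` is chosen with `kμ ∈ [π/6, π/2]`; since `h ≤ μ`, `ky` stays in
  -- `[π/12, 3π/4]`.
  · obtain ⟨j, hj1, hj2⟩ := exists_odd_le (x := π / 2 / μ) (by rw [le_div_iff₀ hμ0]; linarith)
    rw [le_div_iff₀ hμ0] at hj1
    rw [div_le_iff₀ hμ0] at hj2
    have hk : (0 : ℝ) < 2 * j + 1 := by positivity
    have h1 : (2 * j + 1) * h ≤ (2 * j + 1) * μ := mul_le_mul_of_nonneg_left hμ hk.le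
    have h2 : (2 * j + 1) * μ ≤ (2 * j + 1) * (100 * h) := mul_le_mul_of_nonneg_left hl hk.le
    refine ⟨j, 1, Or.inl rfl, by linarith, by linarith, fun y hy => ?_⟩
    rw [abs_le] at hy
    have h3 : (2 * j + 1) * (μ / 2) ≤ (2 * j + 1) * y :=
      mul_le_mul_of_nonneg_left (by linarith) hk.le
    have h4 : (2 * j + 1) * y ≤ (2 * j + 1) * (μ + μ / 2) :=
      mul_le_mul_of_nonneg_left (by linarith) hk.le
    rw [one_mul]
    rcases le_total ((2 * j + 1) * y) (π / 2) with h5 | h5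
    · have h6 := mul_le_sin (by linarith : 0 ≤ (2 * j + 1) * y) h5
      have h7 : 1 / 2 * ((2 * j + 1) * y) ≤ 2 / π * ((2 * j + 1) * y) := by
        apply mul_le_mul_of_nonneg_right _ (by linarith)
        rw [div_le_div_iff₀ (by norm_num) pi_pos]
        linarith
      linarith
    · linarith [half_le_sin (by linarith : π / 6 ≤ (2 * j + 1) * y) (by linarith)]

/-- The reflection `y ↦ π - y` preserves `sin (ky)` for odd `k`, which reduces to `μ ≤ π/2`. -/
theorem exists_odd_sin {μ h : ℝ} (h0 : 0 < h) (hμ : h ≤ μ) (hμ' : μ ≤ π - h) :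
    ∃ (j : ℕ) (s : ℝ), (s = 1 ∨ s = -1) ∧ 1 / 200 ≤ (2 * j + 1) * h ∧ (2 * j + 1) * h ≤ 2 ∧
      ∀ y, |y - μ| ≤ h / 2 → 1 / 10 ≤ s * sin ((2 * j + 1) * y) := by
  rcases le_total μ (π / 2) with h1 | h1
  · exact exists_odd_sin_of_le h0 hμ h1
  · obtain ⟨j, s, hs, h2, h3, h4⟩ :=
      exists_odd_sin_of_le (μ := π - μ) h0 (by linarith) (by linarith)
    refine ⟨j, s, hs, h2, h3, fun y hy => ?_⟩
    have h5 := h4 (π - y) (by rw [abs_sub_comm] at hy; rwa [sub_sub_sub_cancel_left])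
    rwa [show (2 * (j : ℝ) + 1) * (π - y) = π - (2 * j + 1) * y + j * (2 * π) by ring,
      sin_add_nat_mul_two_pi, sin_pi_sub] at h5

/-- For every interval `[μ - h, μ + h]` in `[0, π]` there is an odd `k ≤ 2 / h` such that `cos (k φ)`
distinguishes the left third of the interval from the right third. -/
theorem exists_odd_cos_gap {μ h : ℝ} (h0 : 0 < h) (hμ : h ≤ μ) (hμ' : μ ≤ π - h) :
    ∃ (j : ℕ) (s : ℝ), (s = 1 ∨ s = -1) ∧ (2 * j + 1) * h ≤ 2 ∧ ∀ t, h / 3 ≤ t → t ≤ h →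
      s * cos ((2 * j + 1) * μ) + 1 / 12000 ≤ s * cos ((2 * j + 1) * (μ - t)) ∧
      s * cos ((2 * j + 1) * (μ + t)) + 1 / 12000 ≤ s * cos ((2 * j + 1) * μ) := by
  have hpi' := pi_gt_three
  have hpi := pi_lt_d2
  obtain ⟨j, s, hs, h1, h2, h3⟩ := exists_odd_sin h0 hμ hμ'
  refine ⟨j, s, hs, h2, fun t ht1 ht2 => ?_⟩
  have hk : (0 : ℝ) < 2 * j + 1 := by positivity
  -- From `kt ≥ 1/600` and `sin x ≥ x/2` comes `1/2400`; the difference of cosines is then at least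
  -- `2 · 1/10 · 1/2400 = 1/12000`.
  have h4 : (2 * j + 1) * (h / 3) ≤ (2 * j + 1) * t := mul_le_mul_of_nonneg_left ht1 hk.le
  have h5 : (2 * j + 1) * t ≤ (2 * j + 1) * h := mul_le_mul_of_nonneg_left ht2 hk.le
  have h6 : 1 / 2400 ≤ sin ((2 * j + 1) * t / 2) := by
    have h6 := mul_le_sin (by linarith : 0 ≤ (2 * j + 1) * t / 2) (by linarith)
    have h7 : 1 / 2 * ((2 * j + 1) * t / 2) ≤ 2 / π * ((2 * j + 1) * t / 2) := by
      apply mul_le_mul_of_nonneg_right _ (by linarith)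
      rw [div_le_div_iff₀ (by norm_num) pi_pos]
      linarith
    linarith
  have h7 (y : ℝ) (hy : |y - μ| ≤ h / 2) :
      1 / 10 * (1 / 2400) ≤ s * sin ((2 * j + 1) * y) * sin ((2 * j + 1) * t / 2) :=
    mul_le_mul (h3 y hy) h6 (by norm_num) (by linarith [h3 y hy])
  have ht0 : 0 ≤ t := by linarith
  constructor
  · have h8 := h7 (μ - t / 2) (by
      rw [sub_sub_cancel_left, abs_neg, abs_of_nonneg (by linarith)]; linarith)
    have h9 : cos ((2 * j + 1) * (μ - t)) - cos ((2 * j + 1) * μ) =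
        2 * sin ((2 * j + 1) * (μ - t / 2)) * sin ((2 * j + 1) * t / 2) := by
      rw [cos_sub_cos, show ((2 * (j : ℝ) + 1) * (μ - t) + (2 * j + 1) * μ) / 2 =
        (2 * j + 1) * (μ - t / 2) by ring, show ((2 * (j : ℝ) + 1) * (μ - t) - (2 * j + 1) * μ) / 2 =
        -((2 * j + 1) * t / 2) by ring, sin_neg]
      ring
    have h10 : s * cos ((2 * j + 1) * (μ - t)) - s * cos ((2 * j + 1) * μ) =
        2 * (s * sin ((2 * j + 1) * (μ - t / 2)) * sin ((2 * j + 1) * t / 2)) := by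
      rw [← mul_sub, h9]; ring
    linarith
  · have h8 := h7 (μ + t / 2) (by
      rw [add_sub_cancel_left, abs_of_nonneg (by linarith)]; linarith)
    have h9 : cos ((2 * j + 1) * μ) - cos ((2 * j + 1) * (μ + t)) =
        2 * sin ((2 * j + 1) * (μ + t / 2)) * sin ((2 * j + 1) * t / 2) := by
      rw [cos_sub_cos, show ((2 * (j : ℝ) + 1) * μ + (2 * j + 1) * (μ + t)) / 2 =
        (2 * j + 1) * (μ + t / 2) by ring, show ((2 * (j : ℝ) + 1) * μ - (2 * j + 1) * (μ + t)) / 2 =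
        -((2 * j + 1) * t / 2) by ring, sin_neg]
      ring
    have h10 : s * cos ((2 * j + 1) * μ) - s * cos ((2 * j + 1) * (μ + t)) =
        2 * (s * sin ((2 * j + 1) * (μ + t / 2)) * sin ((2 * j + 1) * t / 2)) := by
      rw [← mul_sub, h9]; ring
    linarith

end QAlg

noncomputable section

namespace QAlg

open Matrix Function

/-! ### The search -/

section

variable {q : ℕ} (u : ℂ)

theorem Algorithm.prob_mono (Uv Uc : unitaryGroup (Bits q) ℂ) {S S' : Set ℝ} (h : S ⊆ S')
    (A : Algorithm q) : A.prob Uv Uc S ≤ A.prob Uv Uc S' := by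
  induction A with
  | output d => exact Set.indicator_le_indicator_of_subset h (fun _ => zero_le_one) d
  | measure m K next ih =>
    exact Finset.sum_le_sum fun x _ => mul_le_mul_of_nonneg_left (ih x) (sq_nonneg _)

/-- The sign `s` is realised by flagging outcome `0` or outcome `1`. The flag is fixed before the
vectors and unitaries, as a black-box algorithm requires. -/
theorem exists_flagProb (hu : ‖u‖ = 1) (j : ℕ) {s : ℝ} (hs : s = 1 ∨ s = -1) :
    ∃ flag : Bits (width q) → Bool, ∀ (n : ℕ) (v c : EuclideanSpace ℂ (Fin n))
      (Uv Uc : unitaryGroup (Bits q) ℂ) (φ : ℝ), n ≤ 2 ^ q → Prepares Uv v → Prepares Uc c →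
      (u * inner ℂ v c).re = Real.cos φ →
      flagProb Uv Uc (testCircuit q u hu j) flag = (1 + s * Real.cos ((2 * j + 1) * φ)) / 2 := by
  have h (n : ℕ) (v c : EuclideanSpace ℂ (Fin n)) (Uv Uc : unitaryGroup (Bits q) ℂ) (φ : ℝ)
      (hn : n ≤ 2 ^ q) (hv : Prepares Uv v) (hc : Prepares Uc c)
      (hφ : (u * inner ℂ v c).re = Real.cos φ) :
      flagProb Uv Uc (testCircuit q u hu j) (fun x => !x (sysWire 0)) =
        (1 + Real.cos ((2 * j + 1) * φ)) / 2 := by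
    rw [← testCircuit_prob_false u hu hn hv hc φ hφ j]
    simp [flagProb]
  rcases hs with rfl | rfl
  · refine ⟨fun x => !x (sysWire 0), fun n v c Uv Uc φ hn hv hc hφ => ?_⟩
    rw [h n v c Uv Uc φ hn hv hc hφ, one_mul]
  · refine ⟨fun x => x (sysWire 0), fun n v c Uv Uc φ hn hv hc hφ => ?_⟩
    have := flagProb_add_not Uv Uc (testCircuit q u hu j) fun x => x (sysWire 0)
    rw [h n v c Uv Uc φ hn hv hc hφ] at this
    linarith

/-- After `i` stages of the search, each of which shrinks the interval `[μ - h, μ + h]` by the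
factor `2 / 3`, the phase `φ` is known up to `h (2 / 3) ^ i`. -/
theorem exists_search (hu : ‖u‖ = 1) (F : ℝ → ℝ) {δ L : ℝ} (hδ : 0 < δ) (hL : Real.exp (-L) ≤ δ) (hL1 : 1 ≤ L)
    (i : ℕ) (μ h : ℝ) (h0 : 0 < h) (hμ : h ≤ μ) (hμ' : μ ≤ Real.pi - h) :
    ∃ A : Algorithm q,
      (∀ (n : ℕ) (v c : EuclideanSpace ℂ (Fin n)) (Uv Uc : unitaryGroup (Bits q) ℂ) (φ : ℝ),
        n ≤ 2 ^ q → Prepares Uv v → Prepares Uc c → (u * inner ℂ v c).re = Real.cos φ →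
        |φ - μ| ≤ h →
        1 - δ * (1 - (1 / 2) ^ i) ≤
          A.prob Uv Uc {d | ∃ x, |φ - x| ≤ h * (2 / 3) ^ i ∧ d = F x}) ∧
      ∀ T₁ Tv Tc : ℝ≥0, (A.time T₁ Tv Tc : ℝ) ≤ 4608000002 * (Tv + Tc + 11 * (q + 1) * T₁) *
        (2 * L + 6 - (2 / 3) ^ i * (2 * L + 6 + 2 * i)) / (h * (2 / 3) ^ i) := by
  induction i generalizing μ h with
  | zero =>
    refine ⟨.output (F μ), fun n v c Uv Uc φ _ _ _ _ hφ => ?_, fun T₁ Tv Tc => ?_⟩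
    · rw [Algorithm.prob, Set.indicator_of_mem]
      · simp
      · exact ⟨μ, by simpa using hφ, rfl⟩
    · simp [Algorithm.time]
  | succ i ih =>
    obtain ⟨j, s, hs, hj, hgap⟩ := exists_odd_cos_gap h0 hμ hμ'
    obtain ⟨flag, hflag⟩ := exists_flagProb (q := q) u hu j hs
    -- `A` searches the left two thirds and `B` the right two thirds; in the common middle third
    -- either choice is correct.
    obtain ⟨A, hA, hAT⟩ := ih (μ - h / 3) (2 * h / 3) (by linarith) (by linarith) (by linarith)
    obtain ⟨B, hB, hBT⟩ := ih (μ + h / 3) (2 * h / 3) (by linarith) (by linarith) (by linarith)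
    have hh : 2 * h / 3 * (2 / 3) ^ i = h * (2 / 3) ^ (i + 1) := by ring
    rw [hh] at hAT hBT
    simp only [hh] at hA hB
    -- Coarse stages (large `i`) have short circuits, so they can afford more repetitions and get
    -- the smaller error `δ (1/2)^(i+1)`. The constant is `48000 ^ 2`.
    have hr1 := Nat.le_ceil (2304000000 * (L + (i + 1)))
    have hr2 := Nat.ceil_lt_add_one (by positivity : (0 : ℝ) ≤ 2304000000 * (L + (i + 1)))
    set r := ⌈2304000000 * (L + (i + 1))⌉₊ with hr
    -- The threshold is the flag probability at the midpoint; phases further left flag more often.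
    set t := (1 + s * Real.cos ((2 * j + 1) * μ)) / 2 with ht
    classical
    set next : ℕ → Algorithm q := fun k => if t * r ≤ k then A else B with hnext
    refine ⟨repeatTest (testCircuit q u hu j) flag next r 0, ?_, ?_⟩
    · intro n v c Uv Uc φ hn hv hc hφ hφμ
      have hp := hflag n v c Uv Uc φ hn hv hc hφ
      set S := {d | ∃ x, |φ - x| ≤ h * (2 / 3) ^ (i + 1) ∧ d = F x} with hS
      rw [abs_le] at hφμ
      have hη : 0 ≤ δ * (1 - (1 / 2) ^ i) :=
        mul_nonneg hδ.le (sub_nonneg.2 (pow_le_one₀ (by norm_num) (by norm_num)))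
      have hA' (h' : φ ≤ μ + h / 3) : 1 - δ * (1 - (1 / 2) ^ i) ≤ A.prob Uv Uc S :=
        hA n v c Uv Uc φ hn hv hc hφ (by rw [abs_le]; constructor <;> linarith)
      have hB' (h' : μ - h / 3 ≤ φ) : 1 - δ * (1 - (1 / 2) ^ i) ≤ B.prob Uv Uc S :=
        hB n v c Uv Uc φ hn hv hc hφ (by rw [abs_le]; constructor <;> linarith)
      have hexp : Real.exp (-(L + (i + 1))) ≤ δ * (1 / 2) ^ (i + 1) := by
        rw [neg_add, Real.exp_add]
        refine mul_le_mul hL ?_ (Real.exp_nonneg _) hδ.le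
        rw [show -((i : ℝ) + 1) = ((i + 1 : ℕ) : ℝ) * (-1) by push_cast; ring, Real.exp_nat_mul]
        refine pow_le_pow_left₀ (Real.exp_nonneg _) ?_ _
        rw [Real.exp_neg, one_div]
        exact inv_anti₀ (by norm_num) (by linarith [Real.add_one_le_exp 1])
      have hsum : δ * (1 - (1 / 2) ^ (i + 1)) = δ * (1 - (1 / 2) ^ i) + δ * (1 / 2) ^ (i + 1) := by
        ring
      -- The cosine gap `1/12000` is a probability gap `1/24000`. Taking `|l|` to be half of that
      -- bounds the Chernoff exponent by `-r l²`, hence by `-(L + (i+1))`.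
      have hchern (l : ℝ) (hl : |l| = 1 / 48000)
          (hlt : 2 * l ^ 2 ≤ l * (t - flagProb Uv Uc (testCircuit q u hu j) flag))
          (hk : ∀ k : ℕ, 1 - δ * (1 - (1 / 2) ^ i) ≤ (next k).prob Uv Uc S ∨
            0 ≤ l * (k - t * r)) :
          1 - δ * (1 - (1 / 2) ^ (i + 1)) ≤
            (repeatTest (testCircuit q u hu j) flag next r 0).prob Uv Uc S := by
        refine le_trans ?_ (repeatTest_chernoff Uv Uc _ flag next S hη (by rw [hl]; norm_num) r hk)
        have hl2 : l ^ 2 = 1 / 2304000000 := by rw [← sq_abs, hl]; norm_num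
        have : Real.exp (r * (l ^ 2 - l * (t - flagProb Uv Uc (testCircuit q u hu j) flag))) ≤
            Real.exp (-(L + (i + 1))) := by
          rw [Real.exp_le_exp]
          have : r * (l ^ 2 - l * (t - flagProb Uv Uc (testCircuit q u hu j) flag)) ≤
              r * (-l ^ 2) := mul_le_mul_of_nonneg_left (by linarith) (Nat.cast_nonneg _)
          rw [hl2] at this ⊢
          linarith
        linarith
      rcases lt_or_ge (μ + h / 3) φ with hR | hR
      · refine hchern (1 / 48000) (by rw [abs_of_pos]; norm_num) ?_ fun k => ?_
        · have := (hgap (φ - μ) (by linarith) (by linarith)).2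
          rw [add_sub_cancel] at this
          rw [hp, ht]
          linarith
        · simp only [hnext]
          split_ifs with hkt
          · exact Or.inr (mul_nonneg (by norm_num) (by linarith))
          · exact Or.inl (hB' (by linarith))
      · rcases lt_or_ge φ (μ - h / 3) with hL' | hL'
        · refine hchern (-(1 / 48000)) (by rw [abs_neg, abs_of_pos]; norm_num) ?_ fun k => ?_
          · have := (hgap (μ - φ) (by linarith) (by linarith)).1
            rw [sub_sub_cancel] at this
            rw [hp, ht]
            linarith
          · simp only [hnext]
            split_ifs with hkt
            · exact Or.inl (hA' hR)
            · right
              linarith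
        -- In the middle third every count leads to a good continuation, so `z = 0` is allowed.
        · have := repeatTest_prob Uv Uc (testCircuit q u hu j) flag next S (z := 0) (ρ := 0)
            hη le_rfl le_rfl (fun k => Or.inl (by
              simp only [hnext]
              split_ifs
              exacts [hA' hR, hB' hL'])) r 0
          have h2 : 0 ≤ δ * (1 / 2) ^ (i + 1) := by positivity
          linarith
    · intro T₁ Tv Tc
      have h1 := repeatTest_time_le T₁ Tv Tc (testCircuit q u hu j) flag next
        (max (A.time T₁ Tv Tc) (B.time T₁ Tv Tc)) (fun k => by
          simp only [hnext]
          split_ifs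
          exacts [le_max_left _ _, le_max_right _ _]) r 0
      have h2 := NNReal.coe_le_coe.2 h1
      rw [NNReal.coe_add, NNReal.coe_mul, NNReal.coe_max, NNReal.coe_natCast] at h2
      have h3 := max_le (hAT T₁ Tv Tc) (hBT T₁ Tv Tc)
      have h4 := testCircuit_time_le T₁ Tv Tc (q := q) u hu j
      set T : ℝ := Tv + Tc + 11 * (q + 1) * T₁ with hT
      have hT0 : 0 ≤ T := by positivity
      have h5 : r * (Circuit.time T₁ Tv Tc (testCircuit q u hu j) : ℝ) ≤
          (2304000001 * (L + (i + 1))) * (2 / h * T) := by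
        refine mul_le_mul ?_ (h4.trans ?_) (NNReal.coe_nonneg _) (by positivity)
        · have : (0 : ℝ) ≤ i := Nat.cast_nonneg _
          linarith
        · exact mul_le_mul_of_nonneg_right ((le_div_iff₀ h0).2 hj) hT0
      -- The numerator of the time bound after `i` stages is the sum of `(2/3)^k (L + k)` over `1 ≤
      -- k ≤ i`, so this stage adds exactly the next term.
      refine h2.trans ((add_le_add h5 h3).trans (le_of_eq ?_))
      have : ((2 : ℝ) / 3) ^ i ≠ 0 := by positivity
      rw [pow_succ]
      push_cast
      field_simp
      ring

end

end QAlg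

end

namespace QAlg

/-! ### The distance as a function of the phase -/

/-- The third side of a triangle with sides `a` and `b` at the angle `φ`. -/
noncomputable def thirdSide (a b φ : ℝ) : ℝ := ‖(a : ℂ) - b * Complex.exp (Complex.I * φ)‖

theorem thirdSide_nonneg (a b φ : ℝ) : 0 ≤ thirdSide a b φ := norm_nonneg _

theorem norm_exp_sub_exp_le (φ x : ℝ) :
    ‖Complex.exp (Complex.I * φ) - Complex.exp (Complex.I * x)‖ ≤ |φ - x| := by
  have h : Complex.exp (Complex.I * φ) - Complex.exp (Complex.I * x) =
      Complex.exp (Complex.I * x) * (Complex.exp (Complex.I * ((φ - x : ℝ) : ℂ)) - 1) := by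
    rw [mul_sub, ← Complex.exp_add, mul_one]
    congr 2
    push_cast
    ring
  rw [h, norm_mul, mul_comm Complex.I (x : ℂ), Complex.norm_exp_ofReal_mul_I, one_mul]
  exact Real.norm_exp_I_mul_ofReal_sub_one_le

theorem thirdSide_sq (a b φ : ℝ) :
    thirdSide a b φ ^ 2 = a ^ 2 + b ^ 2 - 2 * a * b * Real.cos φ := by
  rw [thirdSide, mul_comm Complex.I, Complex.exp_mul_I, ← Complex.ofReal_cos, ← Complex.ofReal_sin,
    ← Complex.normSq_eq_norm_sq, Complex.normSq_apply]
  simp [-Complex.ofReal_cos, -Complex.ofReal_sin]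
  linear_combination b ^ 2 * Real.sin_sq_add_cos_sq φ

theorem thirdSide_comm (a b φ : ℝ) : thirdSide a b φ = thirdSide b a φ := by
  rw [← abs_of_nonneg (thirdSide_nonneg a b φ),
    ← abs_of_nonneg (thirdSide_nonneg b a φ), ← sq_eq_sq_iff_abs_eq_abs,
    thirdSide_sq, thirdSide_sq]
  ring

theorem abs_thirdSide_sub_le_right {a b : ℝ} (hb : 0 ≤ b) (φ x : ℝ) :
    |thirdSide a b φ - thirdSide a b x| ≤ b * |φ - x| := by
  refine (abs_norm_sub_norm_le _ _).trans ?_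
  rw [sub_sub_sub_cancel_left, ← mul_sub, norm_mul, Complex.norm_real, Real.norm_of_nonneg hb,
    abs_sub_comm]
  exact mul_le_mul_of_nonneg_left (norm_exp_sub_exp_le x φ) hb

/-- Turning one side moves its endpoint by at most its length times the angle; by symmetry the
shorter side may be turned. -/
theorem abs_thirdSide_sub_le {a b : ℝ} (ha : 0 ≤ a) (hb : 0 ≤ b) (φ x : ℝ) :
    |thirdSide a b φ - thirdSide a b x| ≤ min a b * |φ - x| := by
  rcases min_choice a b with h | h <;> rw [h]
  · rw [thirdSide_comm a b, thirdSide_comm a b]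
    exact abs_thirdSide_sub_le_right ha φ x
  · exact abs_thirdSide_sub_le_right hb φ x

/-- If `u` is the phase of `conj α * β`, then the distance depends on `v` and `c` only through
the angle with cosine `re (u * ⟪v, c⟫)`. -/
theorem norm_smul_sub_smul_eq_thirdSide {n : ℕ} {v c : EuclideanSpace ℂ (Fin n)} (hv : ‖v‖ = 1)
    (hc : ‖c‖ = 1) {α β u : ℂ} (hu : star α * β = ‖α‖ * ‖β‖ * u) {φ : ℝ}
    (hφ : (u * inner ℂ v c).re = Real.cos φ) :
    ‖α • v - β • c‖ = thirdSide ‖α‖ ‖β‖ φ := by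
  rw [← abs_of_nonneg (norm_nonneg (α • v - β • c)),
    ← abs_of_nonneg (thirdSide_nonneg ‖α‖ ‖β‖ φ), ← sq_eq_sq_iff_abs_eq_abs,
    thirdSide_sq, norm_sub_sq (𝕜 := ℂ), norm_smul, norm_smul, hv, hc, inner_smul_left,
    inner_smul_right, ← mul_assoc]
  rw [Complex.star_def] at hu
  rw [hu, mul_assoc, ← Complex.ofReal_mul, RCLike.re_eq_complex_re, Complex.re_ofReal_mul, hφ]
  ring

end QAlg

/-! ### Choice of the precision and assembly of the bounds -/

theorem mainTheorem12 :
    ∃ C : ℝ, 0 < C ∧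
      ∀ (n : ℕ) (α β : ℂ), 1 ≤ max ‖α‖ ‖β‖ →
      ∀ δ : ℝ, 0 < δ → ∀ ε : ℝ, 0 < ε →
      ∃ A : QAlg.Algorithm (Nat.clog 2 n),
        -- correctness, for all vectors and all unitaries preparing them
        (∀ v c : EuclideanSpace ℂ (Fin n), ‖v‖ = 1 → ‖c‖ = 1 →
          ∀ Uv Uc : Matrix.unitaryGroup (QAlg.Bits (Nat.clog 2 n)) ℂ,
            QAlg.Prepares Uv v → QAlg.Prepares Uc c →
            1 - δ < A.prob Uv Uc {d : ℝ | |d - ‖α • v - β • c‖| ≤ ε}) ∧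
        -- time spent in the calls of the two unitaries
        (∀ Tv Tc : NNReal,
          (A.time 0 Tv Tc : ℝ) ≤
            C * ((Tv + Tc) * (‖α‖ * ‖β‖ / ε) * max 1 (Real.log (1 / δ)))) ∧
        -- total time, with one- and two-qubit gates taking unit time
        (∀ Tv Tc : NNReal, 1 ≤ (Tv + Tc : ℝ) → (Nat.clog 2 n : ℝ) ≤ 2 * (Tv + Tc) →
          (A.time 1 Tv Tc : ℝ) ≤
            C * ((Tv + Tc) * (‖α‖ * ‖β‖ / ε) * max 1 (Real.log (1 / δ)))) := by
  refine ⟨12 * 34 * 4608000002, by norm_num, fun n α β hmax δ hδ ε hε => ?_⟩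
  have ha : 0 ≤ ‖α‖ := norm_nonneg α
  have hb : 0 ≤ ‖β‖ := norm_nonneg β
  rcases le_or_gt (min ‖α‖ ‖β‖) ε with hm | hm
  -- By the triangle inequality `d` differs from the larger weight by at most the smaller one.
  · refine ⟨.output (max ‖α‖ ‖β‖), fun v c hv hc Uv Uc _ _ => ?_, fun Tv Tc => ?_,
      fun Tv Tc _ _ => ?_⟩
    · rw [QAlg.Algorithm.prob, Set.indicator_of_mem]
      · linarith
      · have h1 := norm_sub_le (α • v) (β • c)
        have h2 := norm_sub_norm_le (α • v) (β • c)
        have h3 := norm_sub_norm_le (β • c) (α • v)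
        rw [norm_sub_rev (β • c)] at h3
        rw [norm_smul, norm_smul, hv, hc, mul_one, mul_one] at h1 h2 h3
        rw [Set.mem_ofPred_eq, abs_le]
        rcases le_total ‖α‖ ‖β‖ with h | h
        · rw [min_eq_left h] at hm
          rw [max_eq_right h]
          constructor <;> linarith
        · rw [min_eq_right h] at hm
          rw [max_eq_left h]
          constructor <;> linarith
    · rw [QAlg.Algorithm.time, NNReal.coe_zero]
      positivity
    · rw [QAlg.Algorithm.time, NNReal.coe_zero]
      positivity
  · have ha' : 0 < ‖α‖ := hε.trans (hm.trans_le (min_le_left _ _))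
    have hb' : 0 < ‖β‖ := hε.trans (hm.trans_le (min_le_right _ _))
    have hpi := Real.pi_pos
    set m := min ‖α‖ ‖β‖ with hmdef
    have hm0 : 0 < m := hε.trans hm
    -- The normalisation of the weights enters here, through `‖α‖ * ‖β‖ = min * max`.
    have hmab : m ≤ ‖α‖ * ‖β‖ := by
      rw [← min_mul_max]
      exact le_mul_of_one_le_right hm0.le hmax
    set L := max 1 (Real.log (1 / δ)) with hLdef
    have hL1 : 1 ≤ L := le_max_left _ _
    have hL : Real.exp (-L) ≤ δ := by
      have h1 : Real.log (1 / δ) ≤ L := le_max_right _ _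
      rw [one_div, Real.log_inv] at h1
      calc Real.exp (-L) ≤ Real.exp (Real.log δ) := Real.exp_le_exp.2 (by linarith)
        _ = δ := Real.exp_log hδ
    set u : ℂ := star α * β / (‖α‖ * ‖β‖ : ℝ) with hudef
    have hab : ((‖α‖ * ‖β‖ : ℝ) : ℂ) ≠ 0 := Complex.ofReal_ne_zero.2 (by positivity)
    have hu : ‖u‖ = 1 := by
      rw [hudef, norm_div, norm_mul, norm_star, Complex.norm_real, Real.norm_of_nonneg
        (by positivity), div_self (by positivity)]
    have hu' : star α * β = ‖α‖ * ‖β‖ * u := by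
      rw [hudef, ← Complex.ofReal_mul, mul_div_cancel₀ _ hab]
    have hx1 : 2 * (ε / m) / Real.pi ≤ 1 := by
      rw [div_le_one hpi]
      have : ε / m ≤ 1 := (div_le_one hm0).2 hm.le
      linarith [Real.pi_gt_three]
    -- With `N + 1` stages from radius `π/2`, the final radius lies between `(2/3)(ε/m)` and `ε/m`:
    -- small enough for accuracy, large enough for the cost.
    obtain ⟨N, hN1, hN2⟩ := exists_nat_pow_near_of_lt_one
      (by positivity : 0 < 2 * (ε / m) / Real.pi) hx1
      (by norm_num : (0 : ℝ) < 2 / 3) (by norm_num)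
    rw [lt_div_iff₀ hpi] at hN1
    rw [div_le_iff₀ hpi] at hN2
    obtain ⟨A, hA, hAT⟩ := QAlg.exists_search (q := Nat.clog 2 n) u hu
      (QAlg.thirdSide ‖α‖ ‖β‖) hδ hL hL1 (N + 1) (Real.pi / 2) (Real.pi / 2) (by positivity) le_rfl
      (by linarith)
    -- From `q ≤ 2(Tv + Tc)` and `1 ≤ Tv + Tc` one gets `11(q+1) ≤ 33(Tv + Tc)`, hence the factor
    -- `34`; the factor `12` is `8 / (2/3)`.
    have hT (T₁ Tv Tc : NNReal) (h : (11 * ((Nat.clog 2 n : ℝ) + 1)) * T₁ ≤ 33 * (Tv + Tc)) :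
        (A.time T₁ Tv Tc : ℝ) ≤ 12 * 34 * 4608000002 * ((Tv + Tc) * (‖α‖ * ‖β‖ / ε) * L) := by
      refine (hAT T₁ Tv Tc).trans ?_
      have h1 : 2 / 3 * (ε / m) ≤ Real.pi / 2 * (2 / 3) ^ (N + 1) := by
        rw [pow_succ]
        linarith
      have h2 : 2 * L + 6 - (2 / 3) ^ (N + 1) * (2 * L + 6 + 2 * ((N + 1 : ℕ) : ℝ)) ≤ 8 * L := by
        have : 0 ≤ ((2 : ℝ) / 3) ^ (N + 1) * (2 * L + 6 + 2 * ((N + 1 : ℕ) : ℝ)) := by positivity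
        linarith
      have hT0 : 0 ≤ (Tv + Tc : ℝ) := by positivity
      calc _ ≤ 4608000002 * (34 * (Tv + Tc : ℝ)) * (8 * L) / (2 / 3 * (ε / m)) := by
            refine div_le_div₀ (by positivity) ?_ (by positivity) h1
            refine (mul_le_mul_of_nonneg_left h2 (by positivity)).trans ?_
            refine mul_le_mul_of_nonneg_right ?_ (by positivity)
            linarith
        _ = 12 * 34 * 4608000002 * ((Tv + Tc) * (m / ε) * L) := by
            field_simp
            ring
        _ ≤ _ := by gcongr
    refine ⟨A, fun v c hv hc Uv Uc hUv hUc => ?_, fun Tv Tc => hT 0 Tv Tc ?_,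
      fun Tv Tc h1 h2 => hT 1 Tv Tc ?_⟩
    · have hre : |(u * inner ℂ v c).re| ≤ 1 := by
        refine (Complex.abs_re_le_norm _).trans ?_
        rw [norm_mul, hu, one_mul]
        refine (norm_inner_le_norm v c).trans ?_
        rw [hv, hc, one_mul]
      have hφ := (Real.cos_arccos (abs_le.1 hre).1 (abs_le.1 hre).2).symm
      set φ := Real.arccos (u * inner ℂ v c).re with hφdef
      have hφ0 : 0 ≤ φ := Real.arccos_nonneg _
      have hφπ : φ ≤ Real.pi := Real.arccos_le_pi _
      have h1 := hA n v c Uv Uc φ (Nat.le_pow_clog (by norm_num) n) hUv hUc hφ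
        (by rw [abs_le]; constructor <;> linarith)
      -- The search fails with probability at most `δ (1 - (1/2)^(N+1))`, which gives the strict
      -- inequality.
      have h2 : 0 < δ * (1 / 2) ^ (N + 1) := by positivity
      refine lt_of_lt_of_le (by linarith) (h1.trans (QAlg.Algorithm.prob_mono Uv Uc ?_ A))
      rintro d ⟨x, hx, rfl⟩
      rw [Set.mem_ofPred_eq, QAlg.norm_smul_sub_smul_eq_thirdSide hv hc hu' hφ, abs_sub_comm]
      refine (QAlg.abs_thirdSide_sub_le ha hb φ x).trans ?_
      calc m * |φ - x| ≤ m * (ε / m) := mul_le_mul_of_nonneg_left (by linarith) hm0.le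
        _ = ε := mul_div_cancel₀ _ hm0.ne'
    · rw [NNReal.coe_zero, mul_zero]
      positivity
    · rw [NNReal.coe_one, mul_one]
      linarith
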